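/- Notation. For unit vectors $v_1,\dots,v_n\in\mathbb R^d$, a one-round protocol consists of a local randomizer $R$ (client $i$ sends an independent message $R(v_i)$) and a server map $A$ estimating $\frac1n\sum_i v_i$; $R$ is $\varepsilon$-DP if $\Pr[R(v)\in T]\le e^{\varepsilon}\Pr[R(v')\in T]$ for all inputs $v,v'$ and all measurable $T$. $\mathrm{PrivUnitG}(p,q)$ in dimension $d$, with $p\in[0,1]$, $q\in(0,1)$, acts on a unit vector $v\in\mathbb R^d$ as follows. Put $\sigma=1/\sqrt d$, $\gamma=\sigma\Phi^{-1}(q)$ and $m=\sigma\varphi(\gamma/\sigma)\bigl(\frac p{1-q}-\frac{1-p}q\bigr)\neq0$, where $\Phi,\varphi$ are the standard normal distribution function and density. With $U\sim N(0,\sigma^2)$, draw $a\sim(U\mid U\ge\gamma)$ with probability $p$ and $a\sim(U\mid U<\gamma)$ with probability $1-p$; draw independently $V^\perp\sim N(0,\sigma^2(I-vv^\top))$; output $\frac1m(av+V^\perp)$. Its server averages the messages. For $\varepsilon>0$, optimized parameters in dimension $d$ are parameters $(p,q)$ that minimize the worst-case expected squared error (over unit vectors $v$, for one client) among all $(p,q)$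 for which $\mathrm{PrivUnitG}(p,q)$ in dimension $d$ is well defined and $\varepsilon$-DP. Write $\mathrm{err}_{n,d}(\mathrm{PrivUnitG})$ for the supremum over unit vectors $v_1,\dots,v_n\in\mathbb R^d$ of the expected squared error of the protocol with optimized parameters in dimension $d$. Theorem. Optimized parameters exist for every $d\ge1$ and every $\varepsilon>0$. Moreover, there is an absolute constant $C>0$ such that the following holds. Let $1\le k\le d$, $d\ge2$, $\varepsilon>0$, $n\ge 1$, $\alpha\ge0$, $\beta\in\mathbb R$, and let $\mathcal W$ be a probability distribution on $\mathbb R^{k\times d}$. For $W\sim\mathcal W$ and a unit vector $v\in\mathbb R^d$ write $u_W(v)=Wv/\|Wv\|$, where $u_W(v)$ is a fixed arbitrary unit vector $u_0\in\mathbb R^k$ if $Wv=0$ (so the choice of $u_0$ is immaterial if $Wv\neq0$ almost surely), and suppose that 1. $\mathbb E\|W^\top\|^2\le \frac dk+\beta$ (in particular this expectation is finite), with $\|\cdot\|$ the operator norm; 2. $\bigl\|\mathbb E[W^\top u_W(v)]-v\bigr\|\le\sqrt\alpha$ for every unit vector $v\in\mathbb R^d$, that is, $\bigl\|\mathbb E\bigl[\frac{W^\top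 Wv}{\|Wv\|}\bigr]-v\bigr\|\le\sqrt\alpha$ when $Wv\ne0$ almost surely. Consider the protocol in which client $i$ independently samples $W_i\sim\mathcal W$, applies $\mathrm{PrivUnitG}$ in dimension $k$ with optimized parameters to $u_{W_i}(v_i)$, obtaining $\hat u_i$, and sends $(\hat u_i,W_i)$; the server returns $\hat\mu=\frac1n\sum_{i=1}^nW_i^\top\hat u_i$. Then the local randomizer is $\varepsilon$-DP (for all inputs in $\mathbb R^d$), and for all unit vectors $v_1,\dots,v_n\in\mathbb R^d$, $$\mathbb E\Bigl\|\hat\mu-\frac1n\sum_{i=1}^nv_i\Bigr\|^2\le \mathrm{err}_{n,d}(\mathrm{PrivUnitG})\left(1+\frac{k\beta}d+C\Bigl(1+\frac{k\beta}d\Bigr)\frac{\varepsilon+\log k}{k}\right)+\alpha .$$ In particular, as long as $k\beta/d=O(1)$, the bound is $\mathrm{err}_{n,d}(\mathrm{PrivUnitG})\bigl(1+\frac{k\beta}d+O\bigl(\frac{\varepsilon+\log k}k\bigr)\bigr)+\alpha$. -/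

import Mathlib

open MeasureTheory ProbabilityTheory
open scoped ENNReal NNReal

namespace ProjUnit

noncomputable section

/-- `d`-dimensional Euclidean space. -/
abbrev E (d : ℕ) : Type := EuclideanSpace ℝ (Fin d)

/-- The unit sphere of `d`-dimensional Euclidean space. -/
abbrev S (d : ℕ) : Type := Metric.sphere (0 : E d) 1

/-! ### Local randomizers and mean estimation protocols -/

/-- A local randomizer, given as the law of the message `R x` of a client with input `x`, is
`ε`-differentially private. -/
def IsDP {X Y : Type*} [MeasurableSpace Y] (ε : ℝ) (R : X → Measure Y) : Prop :=
  ∀ x x' : X, ∀ T : Set Y, MeasurableSet T → R x T ≤ ENNReal.ofReal (Real.exp ε) * R x' T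

/-- The expected squared error, for the inputs `v₁, …, vₙ`, of the protocol in which client `i`
sends an independent message of law `R vᵢ` and the server estimates the mean by `A`. -/
def mse {n d : ℕ} {Y : Type*} [MeasurableSpace Y] (A : (Fin n → Y) → E d) (R : S d → Measure Y)
    (v : Fin n → S d) : ℝ≥0∞ :=
  ∫⁻ y, ENNReal.ofReal (‖A y - (n : ℝ)⁻¹ • ∑ i, (v i : E d)‖ ^ 2)
    ∂(Measure.pi fun i => R (v i))

/-- The worst-case expected squared error of a protocol over all tuples of unit vectors. -/
def err {n d : ℕ} {Y : Type*} [MeasurableSpace Y] (A : (Fin n → Y) → E d) (R : S d → Measure Y) :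
    ℝ≥0∞ :=
  ⨆ v : Fin n → S d, mse A R v

/-! ### PrivUnitG -/

/-- The quantile function `Φ⁻¹` of the standard normal distribution, for `0 < q < 1`. -/
def normalQuantile (q : ℝ) : ℝ := sInf {x : ℝ | q ≤ cdf (gaussianReal 0 1) x}

/-- The standard deviation `σ = 1 / √d`. -/
def sigma (d : ℕ) : ℝ := 1 / Real.sqrt d

/-- The threshold `γ = σ Φ⁻¹(q)`. -/
def gam (d : ℕ) (q : ℝ) : ℝ := sigma d * normalQuantile q

/-- The normalizing constant
`m = σ φ(γ / σ) (p / (1 - q) - (1 - p) / q)`, with `φ` the standard normal density. -/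
def mConst (d : ℕ) (p q : ℝ) : ℝ :=
  sigma d * gaussianPDFReal 0 1 (gam d q / sigma d) * (p / (1 - q) - (1 - p) / q)

/-- The law of `α`: with `U ∼ N(0, 1/d)`, draw `z ∼ Ber(p)`, and then draw `α` from the law of `U`
given `U ≥ γ` if `z = 1`, and from the law of `U` given `U < γ` if `z = 0`. -/
def alphaLaw (d : ℕ) (p q : ℝ) : Measure ℝ :=
  ENNReal.ofReal p • (gaussianReal 0 (1 / (d : ℝ≥0)))[|Set.Ici (gam d q)] +
    ENNReal.ofReal (1 - p) • (gaussianReal 0 (1 / (d : ℝ≥0)))[|Set.Iio (gam d q)]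

/-- The law of the randomness used by one call of PrivUnitG: a pair `(α, g)` with `α` as above and,
independently, a standard Gaussian vector `g`. -/
def noiseLaw (d : ℕ) (p q : ℝ) : Measure (ℝ × E d) :=
  (alphaLaw d p q).prod (stdGaussian (E d))

/-- The output `(1 / m) (α v + V⊥)` of PrivUnitG on `v`, where `V⊥ = σ (g - ⟨v, g⟩ v)`, which has
law `N(0, σ² (I - v vᵀ))` when `g` is standard Gaussian. -/
def privUnitGSample (d : ℕ) (p q : ℝ) (v : S d) (ω : ℝ × E d) : E d :=
  (1 / mConst d p q) •
    (ω.1 • (v : E d) + sigma d • (ω.2 - inner ℝ (v : E d) ω.2 • (v : E d)))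

/-- The local randomizer PrivUnitG with parameters `p, q` in dimension `d`. -/
def privUnitG (d : ℕ) (p q : ℝ) (v : S d) : Measure (E d) :=
  (noiseLaw d p q).map (privUnitGSample d p q v)

/-- The server of the PrivUnitG protocol averages the messages. -/
def average {n d : ℕ} (y : Fin n → E d) : E d := (n : ℝ)⁻¹ • ∑ i, y i

/-- `err_{n,d}` of the PrivUnitG protocol with parameters `p, q`. -/
def errPrivUnitG (n d : ℕ) (p q : ℝ) : ℝ≥0∞ := err (n := n) average (privUnitG d p q)

/-- Parameters for which PrivUnitG in dimension `d` is well defined (in particular `m ≠ 0`) and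
`ε`-differentially private. -/
structure Admissible (d : ℕ) (ε p q : ℝ) : Prop where
  p_mem : p ∈ Set.Icc (0 : ℝ) 1
  q_mem : q ∈ Set.Ioo (0 : ℝ) 1
  m_ne_zero : mConst d p q ≠ 0
  isDP : IsDP ε (privUnitG d p q)

/-- The optimized parameters: those that minimize the mean squared error of (one call of) PrivUnitG
among all parameters for which it is `ε`-differentially private. -/
structure Optimal (d : ℕ) (ε p q : ℝ) : Prop where
  admissible : Admissible d ε p q
  le : ∀ p' q' : ℝ, Admissible d ε p' q' → errPrivUnitG 1 d p q ≤ errPrivUnitG 1 d p' q'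

/-! ### Projected PrivUnitG -/

/-- The normalization `x / ‖x‖`, with a fixed unit vector `u₀` in place of the undefined `0 / ‖0‖`. -/
def normalizeOr {k : ℕ} (u₀ : S k) (x : E k) : S k :=
  if h : x = 0 then u₀ else ⟨‖x‖⁻¹ • x, by
    have hx : ‖x‖ ≠ 0 := norm_ne_zero_iff.mpr h
    simp [norm_smul, hx]⟩

/-- The client on input `v`: sample a `k × d` matrix `W` from `μW`, apply PrivUnitG in dimension `k`
to the normalization of `W v`, and send the result together with `W`. -/
def projClient {k d : ℕ} (μW : Measure (E d →L[ℝ] E k)) (u₀ : S k) (p q : ℝ) (v : E d) :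
    Measure (E k × (E d →L[ℝ] E k)) :=
  (μW.prod (noiseLaw k p q)).map fun ω =>
    (privUnitGSample k p q (normalizeOr u₀ (ω.1 v)) ω.2, ω.1)

/-- The server: from the messages `(ûᵢ, Wᵢ)` compute `(1 / n) ∑ᵢ Wᵢᵀ ûᵢ`. -/
def projServer {n k d : ℕ} (y : Fin n → E k × (E d →L[ℝ] E k)) : E d :=
  (n : ℝ)⁻¹ • ∑ i, ContinuousLinearMap.adjoint (y i).2 (y i).1

end

end ProjUnit

/-!
Write `t = Φ⁻¹(q)` and `M = φ(t) (p / (1 - q) - (1 - p) / q)` (`signal`), so that `m = σ M`.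

*One call of PrivUnitG.* The law of `α` is a centred Gaussian reweighted by `p / (1 - q)` above the
threshold and by `(1 - p) / q` below it (`alphaLaw_eq`). Its mean is `σ M` and its second moment is
`σ² (1 + t M)`, so PrivUnitG is unbiased with squared error `(d + t M) / M² - 1` (`unitErr`). If `α`
were an unconditioned Gaussian, the message would be an isotropic Gaussian vector whatever the input
(`charFun_map_privUnitGSample`). Hence `ε`-differential privacy means exactly that the two weights
are within a factor `e ^ ε` of each other (`admissible_iff`), a condition in which the dimension
does not appear.

*Existence of optimized parameters.* For a given threshold the error decreases in `M > 0`
(`error_antitone_signal`), so the ratio of the weights should be `e ^ ε`; the case `M < 0` reduces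
to this one by reflecting `t` to `-t`. What is left is a continuous function of `t ∈ ℝ` that tends
to infinity at `±∞` (`exists_min_maxSignal`).

*Comparison of dimensions.* Parameters optimized for dimension `d` are admissible in dimension `k`,
so the optimal error in dimension `k` is at most `(k + t M) / M² - 1`, with `t` and `M` those of
dimension `d`. Privacy forces `t M ≤ 5 ε` and `M² ≤ 6 ε`, and the error in dimension `d` is at least
`(d - 1) / M²`. Together these give
`(d / k) (err_k + 1) ≤ err_d (1 + 22 ε / k)` (`div_mul_unitErr_add_one_le`).

*The projected protocol.* By the bias-variance decomposition for independent messages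
(`lintegral_norm_average_sub_sq`), its error is at most `E ‖Wᵀ‖² (err_k + 1) / n + α`
(`mse_projServer_le`), which the comparison bounds in terms of `err_d / n = err_{n,d}`.
-/

namespace ProjUnit

open Filter Topology Set

/-! ### The standard normal distribution -/

lemma gaussianPDFReal_zero_one (x : ℝ) :
    gaussianPDFReal 0 1 x = (√(2 * Real.pi))⁻¹ * Real.exp (-x ^ 2 / 2) := by
  simp [gaussianPDFReal]

lemma gaussianPDFReal_zero_one_pos (x : ℝ) : 0 < gaussianPDFReal 0 1 x :=
  gaussianPDFReal_pos 0 1 x one_ne_zero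

lemma gaussianPDFReal_zero_one_neg (x : ℝ) :
    gaussianPDFReal 0 1 (-x) = gaussianPDFReal 0 1 x := by
  simp [gaussianPDFReal_zero_one]

lemma gaussianPDFReal_zero_one_le (x : ℝ) :
    gaussianPDFReal 0 1 x ≤ 1 / 2 * Real.exp (-x ^ 2 / 2) := by
  rw [gaussianPDFReal_zero_one]
  gcongr
  rw [one_div]
  gcongr
  refine Real.le_sqrt_of_sq_le ?_
  nlinarith [Real.pi_gt_three]

lemma hasDerivAt_gaussianPDFReal_zero_one (x : ℝ) :
    HasDerivAt (gaussianPDFReal 0 1) (-(x * gaussianPDFReal 0 1 x)) x := by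
  have h : HasDerivAt (fun y : ℝ => (√(2 * Real.pi))⁻¹ * Real.exp (-y ^ 2 / 2))
      ((√(2 * Real.pi))⁻¹ * (Real.exp (-x ^ 2 / 2) * (-(2 * x) / 2))) x := by
    have h1 : HasDerivAt (fun y : ℝ => -y ^ 2 / 2) (-(2 * x) / 2) x := by
      simpa using ((hasDerivAt_pow 2 x).neg).div_const 2
    exact h1.exp.const_mul _
  have h2 : gaussianPDFReal 0 1 = fun y : ℝ => (√(2 * Real.pi))⁻¹ * Real.exp (-y ^ 2 / 2) :=
    funext gaussianPDFReal_zero_one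
  rw [gaussianPDFReal_zero_one, h2]
  convert h using 1
  ring

instance : NullSingletonClass (gaussianReal 0 1) := nullSingletonClass_gaussianReal one_ne_zero

instance : (gaussianReal 0 1).IsOpenPosMeasure :=
  (gaussianReal_absolutelyContinuous' 0 one_ne_zero).isOpenPosMeasure

lemma strictMono_cdf_gaussianReal : StrictMono (cdf (gaussianReal 0 1)) := by
  intro x y hxy
  have h : 0 < gaussianReal 0 1 (Ioc x y) :=
    (isOpen_Ioo.measure_pos _ (nonempty_Ioo.2 hxy)).trans_le (measure_mono Ioo_subset_Ioc_self)
  rw [← measure_cdf (gaussianReal 0 1), StieltjesFunction.measure_Ioc, ENNReal.ofReal_pos] at h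
  linarith

lemma continuous_cdf_gaussianReal : Continuous (cdf (gaussianReal 0 1)) := by
  rw [continuous_iff_continuousAt]
  intro x
  rw [(monotone_cdf _).continuousAt_iff_leftLim_eq_rightLim, StieltjesFunction.rightLim_eq]
  have h := (cdf (gaussianReal 0 1)).measure_singleton x
  rw [measure_cdf, measure_singleton, eq_comm, ENNReal.ofReal_eq_zero] at h
  exact le_antisymm ((monotone_cdf _).leftLim_le le_rfl) (by linarith)

lemma cdf_gaussianReal_pos (x : ℝ) : 0 < cdf (gaussianReal 0 1) x :=
  (cdf_nonneg _ (x - 1)).trans_lt (strictMono_cdf_gaussianReal (by linarith))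

lemma cdf_gaussianReal_lt_one (x : ℝ) : cdf (gaussianReal 0 1) x < 1 :=
  (strictMono_cdf_gaussianReal (by linarith)).trans_le (cdf_le_one _ (x + 1))

lemma normalQuantile_cdf (t : ℝ) : normalQuantile (cdf (gaussianReal 0 1) t) = t := by
  have : {x : ℝ | cdf (gaussianReal 0 1) t ≤ cdf (gaussianReal 0 1) x} = Ici t := by
    ext x
    exact strictMono_cdf_gaussianReal.le_iff_le
  rw [normalQuantile, this, csInf_Ici]

lemma cdf_normalQuantile {q : ℝ} (hq : q ∈ Ioo (0 : ℝ) 1) :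
    cdf (gaussianReal 0 1) (normalQuantile q) = q := by
  obtain ⟨t, rfl⟩ : q ∈ range (cdf (gaussianReal 0 1)) :=
    mem_range_of_exists_le_of_exists_ge continuous_cdf_gaussianReal
      ((tendsto_cdf_atBot _).eventually_le_const hq.1).exists
      ((tendsto_cdf_atTop _).eventually_const_le hq.2).exists
  rw [normalQuantile_cdf]

lemma gaussianReal_real_Iio (t : ℝ) :
    (gaussianReal 0 1).real (Iio t) = cdf (gaussianReal 0 1) t := by
  rw [cdf_eq_real, measureReal_congr Iio_ae_eq_Iic]

lemma gaussianReal_real_Ici (t : ℝ) :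
    (gaussianReal 0 1).real (Ici t) = 1 - cdf (gaussianReal 0 1) t := by
  rw [← gaussianReal_real_Iio, ← compl_Iio, probReal_compl_eq_one_sub measurableSet_Iio]

lemma cdf_gaussianReal_neg (t : ℝ) :
    cdf (gaussianReal 0 1) (-t) = 1 - cdf (gaussianReal 0 1) t := by
  have h : (gaussianReal 0 1).map (fun x => -x) = gaussianReal 0 1 := by
    simpa using gaussianReal_map_neg (μ := 0) (v := 1)
  rw [← gaussianReal_real_Ici, cdf_eq_real]
  conv_lhs => rw [← h]
  rw [map_measureReal_apply measurable_neg measurableSet_Iic]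
  congr 1
  ext x
  simp

lemma integrable_id_gaussianReal : Integrable (fun x : ℝ => x) (gaussianReal 0 1) :=
  (memLp_id_gaussianReal 1).integrable le_rfl

lemma integrable_sq_gaussianReal : Integrable (fun x : ℝ => x ^ 2) (gaussianReal 0 1) :=
  (memLp_id_gaussianReal 2).integrable_sq

lemma integral_sq_gaussianReal : ∫ x, x ^ 2 ∂(gaussianReal 0 1) = 1 := by
  have h := variance_eq_sub (memLp_id_gaussianReal (μ := 0) (v := 1) 2)
  rw [variance_id_gaussianReal] at h
  simpa using h.symm

lemma tendsto_gaussianPDFReal_zero_one_atTop :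
    Tendsto (gaussianPDFReal 0 1) atTop (𝓝 0) ∧
      Tendsto (fun x => x * gaussianPDFReal 0 1 x) atTop (𝓝 0) := by
  have h : Tendsto (fun x : ℝ => (√(2 * Real.pi))⁻¹ * (x ^ 1 * Real.exp (-x))) atTop (𝓝 0) := by
    simpa using (Real.tendsto_pow_mul_exp_neg_atTop_nhds_zero 1).const_mul (√(2 * Real.pi))⁻¹
  have key : ∀ x : ℝ, 2 ≤ x →
      x * gaussianPDFReal 0 1 x ≤ (√(2 * Real.pi))⁻¹ * (x ^ 1 * Real.exp (-x)) := by
    intro x hx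
    rw [gaussianPDFReal_zero_one, pow_one, mul_left_comm]
    gcongr
    nlinarith
  constructor
  · refine squeeze_zero' (.of_forall fun x => (gaussianPDFReal_zero_one_pos x).le) ?_ h
    filter_upwards [eventually_ge_atTop 2] with x hx
    refine le_trans ?_ (key x hx)
    nlinarith [gaussianPDFReal_zero_one_pos x]
  · refine squeeze_zero' ?_ ?_ h
    · filter_upwards [eventually_ge_atTop 2] with x hx
      have := gaussianPDFReal_zero_one_pos x
      positivity
    · filter_upwards [eventually_ge_atTop 2] with x hx using key x hx

lemma setIntegral_gaussianReal {s : Set ℝ} (hs : MeasurableSet s) (f : ℝ → ℝ) :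
    ∫ x in s, f x ∂(gaussianReal 0 1) = ∫ x in s, gaussianPDFReal 0 1 x * f x := by
  rw [← integral_indicator hs, integral_gaussianReal_eq_integral_smul one_ne_zero,
    ← integral_indicator hs]
  congr 1 with x
  by_cases hx : x ∈ s <;> simp [hx]

lemma integrable_gaussianReal_iff (f : ℝ → ℝ) :
    Integrable f (gaussianReal 0 1) ↔ Integrable fun x => gaussianPDFReal 0 1 x * f x := by
  rw [gaussianReal_of_var_ne_zero _ one_ne_zero,
    integrable_withDensity_iff_integrable_smul' (measurable_gaussianPDF 0 1)
      (.of_forall fun _ => gaussianPDF_lt_top)]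
  simp

lemma setIntegral_Ici_id_gaussianReal (t : ℝ) :
    ∫ x in Ici t, x ∂(gaussianReal 0 1) = gaussianPDFReal 0 1 t := by
  rw [setIntegral_gaussianReal measurableSet_Ici, integral_Ici_eq_integral_Ioi]
  have := integral_Ioi_of_hasDerivAt_of_tendsto' (a := t) (f := fun x => -gaussianPDFReal 0 1 x)
    (f' := fun x => gaussianPDFReal 0 1 x * x) (m := 0)
    (fun x _ => by simpa [mul_comm] using (hasDerivAt_gaussianPDFReal_zero_one x).fun_neg)
    ((integrable_gaussianReal_iff _).1 integrable_id_gaussianReal).integrableOn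
    (by simpa using tendsto_gaussianPDFReal_zero_one_atTop.1.neg)
  simpa using this

lemma setIntegral_Ici_sq_gaussianReal (t : ℝ) :
    ∫ x in Ici t, x ^ 2 ∂(gaussianReal 0 1)
      = t * gaussianPDFReal 0 1 t + (1 - cdf (gaussianReal 0 1) t) := by
  have h1 : ∫ x in Ici t, (x ^ 2 - 1) ∂(gaussianReal 0 1) = t * gaussianPDFReal 0 1 t := by
    rw [setIntegral_gaussianReal measurableSet_Ici, integral_Ici_eq_integral_Ioi]
    have := integral_Ioi_of_hasDerivAt_of_tendsto' (a := t)
      (f := fun x => -(x * gaussianPDFReal 0 1 x))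
      (f' := fun x => gaussianPDFReal 0 1 x * (x ^ 2 - 1)) (m := 0)
      (fun x _ => by
        convert ((hasDerivAt_id' x).fun_mul (hasDerivAt_gaussianPDFReal_zero_one x)).fun_neg using 1
        ring)
      ((integrable_gaussianReal_iff _).1
        (integrable_sq_gaussianReal.sub (integrable_const 1))).integrableOn
      (by simpa using tendsto_gaussianPDFReal_zero_one_atTop.2.neg)
    simpa using this
  rw [integral_sub integrable_sq_gaussianReal.integrableOn (integrable_const _)] at h1
  rw [← gaussianReal_real_Ici, ← h1]
  simp

lemma setIntegral_Iio_gaussianReal {f : ℝ → ℝ} (hf : Integrable f (gaussianReal 0 1)) (t : ℝ) :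
    ∫ x in Iio t, f x ∂(gaussianReal 0 1)
      = ∫ x, f x ∂(gaussianReal 0 1) - ∫ x in Ici t, f x ∂(gaussianReal 0 1) := by
  rw [← integral_add_compl (measurableSet_Iio (a := t)) hf, compl_Iio]
  ring

/-! ### The law of PrivUnitG -/

/-- The signal strength `M = φ(t) (p / (1 - q) - (1 - p) / q)` with `t = Φ⁻¹(q)`: the normalizing
constant `m` in units of `σ`, which does not depend on the dimension. -/
noncomputable def signal (p q : ℝ) : ℝ :=
  gaussianPDFReal 0 1 (normalQuantile q) * (p / (1 - q) - (1 - p) / q)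

/-- The squared error `(d + t M) / M² - 1` of one call of PrivUnitG, with `t = Φ⁻¹(q)`. -/
noncomputable def unitErr (d : ℕ) (p q : ℝ) : ℝ :=
  (d + normalQuantile q * signal p q) / signal p q ^ 2 - 1

section

variable {d : ℕ} {p q : ℝ} {f : ℝ → ℝ}

lemma nonempty_sphere (hd : 1 ≤ d) : Nonempty (S d) :=
  ⟨⟨EuclideanSpace.single ⟨0, hd⟩ 1, by simp⟩⟩

lemma sigma_pos (hd : 1 ≤ d) : 0 < sigma d := by
  have : (0 : ℝ) < d := by exact_mod_cast hd
  rw [sigma]; positivity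

lemma sigma_sq (hd : 1 ≤ d) : sigma d ^ 2 = 1 / d := by
  rw [sigma, div_pow, Real.sq_sqrt (by positivity), one_pow]

lemma mConst_eq (hd : 1 ≤ d) : mConst d p q = sigma d * signal p q := by
  rw [mConst, signal, gam, mul_div_cancel_left₀ _ (sigma_pos hd).ne', mul_assoc]

lemma mConst_ne_zero_iff (hd : 1 ≤ d) : mConst d p q ≠ 0 ↔ signal p q ≠ 0 := by
  simp [mConst_eq hd, (sigma_pos hd).ne']

lemma gaussianReal_one_div_eq_map (hd : 1 ≤ d) :
    gaussianReal 0 (1 / (d : ℝ≥0)) = (gaussianReal 0 1).map (sigma d * ·) := by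
  rw [gaussianReal_map_const_mul, mul_zero, mul_one]
  congr 1
  ext
  simp [sigma_sq hd]

lemma gaussianReal_one_div_Iio_gam (hd : 1 ≤ d) (hq : q ∈ Ioo (0 : ℝ) 1) :
    gaussianReal 0 (1 / (d : ℝ≥0)) (Iio (gam d q)) = ENNReal.ofReal q := by
  have : (sigma d * ·) ⁻¹' Iio (gam d q) = Iio (normalQuantile q) := by
    ext x
    exact mul_lt_mul_iff_right₀ (sigma_pos hd)
  rw [gaussianReal_one_div_eq_map hd, Measure.map_apply (by fun_prop) measurableSet_Iio, this,
    ← ofReal_measureReal, gaussianReal_real_Iio, cdf_normalQuantile hq]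

lemma gaussianReal_one_div_Ici_gam (hd : 1 ≤ d) (hq : q ∈ Ioo (0 : ℝ) 1) :
    gaussianReal 0 (1 / (d : ℝ≥0)) (Ici (gam d q)) = ENNReal.ofReal (1 - q) := by
  rw [← compl_Iio, prob_compl_eq_one_sub measurableSet_Iio, gaussianReal_one_div_Iio_gam hd hq,
    ENNReal.ofReal_sub _ hq.1.le, ENNReal.ofReal_one]

/-- The law of `α` is a Gaussian reweighted by `p / (1 - q)` above the threshold and by
`(1 - p) / q` below it. -/
lemma alphaLaw_eq (hd : 1 ≤ d) (hq : q ∈ Ioo (0 : ℝ) 1) :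
    alphaLaw d p q =
      ENNReal.ofReal (p / (1 - q)) • (gaussianReal 0 (1 / (d : ℝ≥0))).restrict (Ici (gam d q)) +
        ENNReal.ofReal ((1 - p) / q) •
          (gaussianReal 0 (1 / (d : ℝ≥0))).restrict (Iio (gam d q)) := by
  rw [alphaLaw, ProbabilityTheory.cond, ProbabilityTheory.cond,
    gaussianReal_one_div_Iio_gam hd hq, gaussianReal_one_div_Ici_gam hd hq, smul_smul, smul_smul,
    ENNReal.ofReal_div_of_pos (by linarith [hq.2]), ENNReal.ofReal_div_of_pos hq.1,
    div_eq_mul_inv (ENNReal.ofReal p), div_eq_mul_inv (ENNReal.ofReal (1 - p))]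

lemma alphaLaw_apply (hd : 1 ≤ d) (hq : q ∈ Ioo (0 : ℝ) 1) {s : Set ℝ} (hs : MeasurableSet s) :
    alphaLaw d p q s =
      ENNReal.ofReal (p / (1 - q)) * gaussianReal 0 (1 / (d : ℝ≥0)) (s ∩ Ici (gam d q)) +
        ENNReal.ofReal ((1 - p) / q) * gaussianReal 0 (1 / (d : ℝ≥0)) (s ∩ Iio (gam d q)) := by
  rw [alphaLaw_eq hd hq]
  simp [Measure.restrict_apply hs]

lemma isProbabilityMeasure_alphaLaw (hd : 1 ≤ d) (hp : p ∈ Icc (0 : ℝ) 1)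
    (hq : q ∈ Ioo (0 : ℝ) 1) : IsProbabilityMeasure (alphaLaw d p q) := by
  constructor
  rw [alphaLaw_apply hd hq .univ, univ_inter, univ_inter, gaussianReal_one_div_Iio_gam hd hq,
    gaussianReal_one_div_Ici_gam hd hq, ← ENNReal.ofReal_mul, ← ENNReal.ofReal_mul,
    div_mul_cancel₀ _ (by linarith [hq.2]), div_mul_cancel₀ _ hq.1.ne',
    ← ENNReal.ofReal_add hp.1 (by linarith [hp.2])]
  · simp
  · exact div_nonneg (by linarith [hp.2]) hq.1.le
  · exact div_nonneg hp.1 (by linarith [hq.2])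

lemma integrable_alphaLaw (hd : 1 ≤ d) (hq : q ∈ Ioo (0 : ℝ) 1)
    (hf : Integrable f (gaussianReal 0 (1 / (d : ℝ≥0)))) : Integrable f (alphaLaw d p q) := by
  rw [alphaLaw_eq hd hq]
  exact (hf.restrict.smul_measure ENNReal.ofReal_ne_top).add_measure
    (hf.restrict.smul_measure ENNReal.ofReal_ne_top)

lemma integrable_gaussianReal_one_div (hd : 1 ≤ d) (hf : Measurable f)
    (h : Integrable (fun x => f (sigma d * x)) (gaussianReal 0 1)) :
    Integrable f (gaussianReal 0 (1 / (d : ℝ≥0))) := by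
  rw [gaussianReal_one_div_eq_map hd]
  exact (integrable_map_measure hf.aestronglyMeasurable (by fun_prop)).2 h

lemma integral_alphaLaw (hd : 1 ≤ d) (hp : p ∈ Icc (0 : ℝ) 1) (hq : q ∈ Ioo (0 : ℝ) 1)
    (hf : Measurable f) (h : Integrable (fun x => f (sigma d * x)) (gaussianReal 0 1)) :
    ∫ x, f x ∂(alphaLaw d p q) =
      p / (1 - q) * ∫ x in Ici (normalQuantile q), f (sigma d * x) ∂(gaussianReal 0 1) +
        (1 - p) / q *
          ∫ x in Iio (normalQuantile q), f (sigma d * x) ∂(gaussianReal 0 1) := by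
  have hN := integrable_gaussianReal_one_div hd hf h
  have h1 : (sigma d * ·) ⁻¹' Iio (gam d q) = Iio (normalQuantile q) := by
    ext x
    exact mul_lt_mul_iff_right₀ (sigma_pos hd)
  have h2 : (sigma d * ·) ⁻¹' Ici (gam d q) = Ici (normalQuantile q) := by
    ext x
    exact mul_le_mul_iff_right₀ (sigma_pos hd)
  rw [alphaLaw_eq hd hq, integral_add_measure
    (hN.restrict.smul_measure ENNReal.ofReal_ne_top)
    (hN.restrict.smul_measure ENNReal.ofReal_ne_top), integral_smul_measure,
    integral_smul_measure, gaussianReal_one_div_eq_map hd,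
    setIntegral_map measurableSet_Ici hf.aestronglyMeasurable (by fun_prop),
    setIntegral_map measurableSet_Iio hf.aestronglyMeasurable (by fun_prop), h1, h2,
    ENNReal.toReal_ofReal (div_nonneg hp.1 (by linarith [hq.2])),
    ENNReal.toReal_ofReal (div_nonneg (by linarith [hp.2]) hq.1.le)]
  rfl

lemma memLp_two_alphaLaw (hd : 1 ≤ d) (hq : q ∈ Ioo (0 : ℝ) 1) :
    MemLp (fun x : ℝ => x) 2 (alphaLaw d p q) := by
  rw [memLp_two_iff_integrable_sq (by fun_prop)]
  exact integrable_alphaLaw hd hq (integrable_gaussianReal_one_div hd (by fun_prop)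
    (by simpa only [mul_pow] using integrable_sq_gaussianReal.const_mul _))

/-- The normalizing constant is the mean of `α`. -/
lemma integral_id_alphaLaw (hd : 1 ≤ d) (hp : p ∈ Icc (0 : ℝ) 1) (hq : q ∈ Ioo (0 : ℝ) 1) :
    ∫ x, x ∂(alphaLaw d p q) = sigma d * signal p q := by
  rw [integral_alphaLaw hd hp hq measurable_id' (integrable_id_gaussianReal.const_mul _),
    integral_const_mul, integral_const_mul,
    setIntegral_Iio_gaussianReal integrable_id_gaussianReal, setIntegral_Ici_id_gaussianReal,
    integral_id_gaussianReal, signal]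
  ring

lemma integral_sq_alphaLaw (hd : 1 ≤ d) (hp : p ∈ Icc (0 : ℝ) 1) (hq : q ∈ Ioo (0 : ℝ) 1) :
    ∫ x, x ^ 2 ∂(alphaLaw d p q) = sigma d ^ 2 * (1 + normalQuantile q * signal p q) := by
  have hq0 := hq.1.ne'
  have hq1 : 1 - q ≠ 0 := by linarith [hq.2]
  rw [integral_alphaLaw hd hp hq (by fun_prop)
    (by simpa only [mul_pow] using integrable_sq_gaussianReal.const_mul _)]
  simp only [mul_pow]
  rw [integral_const_mul, integral_const_mul,
    setIntegral_Iio_gaussianReal integrable_sq_gaussianReal, setIntegral_Ici_sq_gaussianReal,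
    integral_sq_gaussianReal, cdf_normalQuantile hq, signal]
  field_simp
  ring

/-- The variance of `α` is nonnegative. -/
lemma signal_sq_le (hp : p ∈ Icc (0 : ℝ) 1) (hq : q ∈ Ioo (0 : ℝ) 1) :
    signal p q ^ 2 ≤ 1 + normalQuantile q * signal p q := by
  have := isProbabilityMeasure_alphaLaw le_rfl hp hq
  have h := variance_nonneg (fun x : ℝ => x) (alphaLaw 1 p q)
  rw [variance_eq_sub (memLp_two_alphaLaw le_rfl hq)] at h
  simp only [Pi.pow_apply] at h
  rw [integral_id_alphaLaw le_rfl hp hq, integral_sq_alphaLaw le_rfl hp hq, mul_pow,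
    sigma_sq le_rfl] at h
  simpa using h

/-! ### Moments of one message -/

lemma integrable_inner_sq_stdGaussian (u : E d) :
    Integrable (fun g : E d => inner ℝ u g ^ 2) (stdGaussian (E d)) := by
  have h : MemLp (fun g : E d => inner ℝ u g) 2 (stdGaussian (E d)) :=
    MemLp.const_inner u (IsGaussian.memLp_two_id (μ := stdGaussian (E d)))
  exact h.integrable_sq

lemma integral_inner_sq_stdGaussian (u : E d) :
    ∫ g, inner ℝ u g ^ 2 ∂(stdGaussian (E d)) = ‖u‖ ^ 2 := by
  have h : MemLp (innerSL ℝ u) 2 (stdGaussian (E d)) :=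
    MemLp.const_inner u (IsGaussian.memLp_two_id (μ := stdGaussian (E d)))
  have h1 := variance_dual_stdGaussian (innerSL ℝ u)
  rw [variance_eq_sub h, integral_strongDual_stdGaussian, innerSL_apply_norm] at h1
  simpa using h1

lemma integral_norm_sq_stdGaussian :
    ∫ g, ‖g‖ ^ 2 ∂(stdGaussian (E d)) = d := by
  have (g : E d) : ‖g‖ ^ 2 = ∑ i, inner ℝ (EuclideanSpace.basisFun (Fin d) ℝ i) g ^ 2 :=
    ((EuclideanSpace.basisFun (Fin d) ℝ).sum_sq_inner_right g).symm
  simp_rw [this]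
  rw [integral_finsetSum _ fun i _ => integrable_inner_sq_stdGaussian _]
  simp [integral_inner_sq_stdGaussian]

lemma isProbabilityMeasure_noiseLaw (hd : 1 ≤ d) (hp : p ∈ Icc (0 : ℝ) 1)
    (hq : q ∈ Ioo (0 : ℝ) 1) : IsProbabilityMeasure (noiseLaw d p q) := by
  have := isProbabilityMeasure_alphaLaw hd hp hq
  rw [noiseLaw]
  infer_instance

lemma measurable_privUnitGSample_comp {Ω : Type*} [MeasurableSpace Ω] {v : Ω → S d} {a : Ω → ℝ}
    {g : Ω → E d} (hv : Measurable v) (ha : Measurable a) (hg : Measurable g) :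
    Measurable fun x => privUnitGSample d p q (v x) (a x, g x) := by
  have hv' : Measurable fun x => (v x : E d) := measurable_subtype_coe.comp hv
  have hi := hv'.inner hg (𝕜 := ℝ)
  simp only [privUnitGSample]
  generalize hw : (fun x => (v x : E d)) = w at hv'
  simp only [fun x => congrFun hw x] at hi ⊢
  fun_prop

lemma measurable_privUnitGSample (v : S d) : Measurable (privUnitGSample d p q v) :=
  measurable_privUnitGSample_comp measurable_const measurable_fst measurable_snd

lemma norm_sq_privUnitGSample (v : S d) (ω : ℝ × E d) :
    ‖privUnitGSample d p q v ω‖ ^ 2 = (1 / mConst d p q) ^ 2 *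
      (ω.1 ^ 2 + sigma d ^ 2 * (‖ω.2‖ ^ 2 - inner ℝ (v : E d) ω.2 ^ 2)) := by
  have hv : inner ℝ (v : E d) (v : E d) = 1 := by simp
  rw [privUnitGSample, norm_smul, mul_pow, Real.norm_eq_abs, sq_abs]
  congr 1
  rw [← real_inner_self_eq_norm_sq, ← real_inner_self_eq_norm_sq]
  simp only [inner_add_left, inner_add_right, inner_sub_left, inner_sub_right, inner_smul_left,
    inner_smul_right, hv, real_inner_comm (v : E d) ω.2]
  simp
  ring

lemma integrable_norm_sq_privUnitGSample (hd : 1 ≤ d) (hp : p ∈ Icc (0 : ℝ) 1)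
    (hq : q ∈ Ioo (0 : ℝ) 1) (v : S d) :
    Integrable (fun ω => ‖privUnitGSample d p q v ω‖ ^ 2) (noiseLaw d p q) := by
  have := isProbabilityMeasure_alphaLaw hd hp hq
  simp_rw [norm_sq_privUnitGSample, noiseLaw]
  refine Integrable.const_mul (.add ?_ (.const_mul (.sub ?_ ?_) _)) _
  · exact (memLp_two_alphaLaw hd hq).integrable_sq.comp_fst _
  · exact (IsGaussian.memLp_two_id (μ := stdGaussian (E d))).norm.integrable_sq.comp_snd _
  · exact (integrable_inner_sq_stdGaussian _).comp_snd _

lemma integral_norm_sq_privUnitGSample (hd : 1 ≤ d) (hp : p ∈ Icc (0 : ℝ) 1)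
    (hq : q ∈ Ioo (0 : ℝ) 1) (v : S d) (hm : signal p q ≠ 0) :
    ∫ ω, ‖privUnitGSample d p q v ω‖ ^ 2 ∂(noiseLaw d p q) = unitErr d p q + 1 := by
  have := isProbabilityMeasure_alphaLaw hd hp hq
  have h1 : Integrable (fun ω : ℝ × E d => ω.1 ^ 2) (noiseLaw d p q) :=
    (memLp_two_alphaLaw hd hq).integrable_sq.comp_fst _
  have h2 : Integrable (fun ω : ℝ × E d => ‖ω.2‖ ^ 2) (noiseLaw d p q) :=
    (IsGaussian.memLp_two_id (μ := stdGaussian (E d))).norm.integrable_sq.comp_snd _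
  have h3 : Integrable (fun ω : ℝ × E d => inner ℝ (v : E d) ω.2 ^ 2) (noiseLaw d p q) :=
    (integrable_inner_sq_stdGaussian _).comp_snd _
  have h4 : Integrable (fun ω : ℝ × E d => sigma d ^ 2 *
      (‖ω.2‖ ^ 2 - inner ℝ (v : E d) ω.2 ^ 2)) (noiseLaw d p q) := (h2.sub h3).const_mul _
  have e1 : ∫ ω, ω.1 ^ 2 ∂(noiseLaw d p q)
      = sigma d ^ 2 * (1 + normalQuantile q * signal p q) := by
    rw [← integral_sq_alphaLaw hd hp hq, noiseLaw,
      integral_fun_fst (μ := alphaLaw d p q) (ν := stdGaussian (E d)) fun x => x ^ 2]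
    simp
  have e2 : ∫ ω, ‖ω.2‖ ^ 2 ∂(noiseLaw d p q) = d := by
    rw [← integral_norm_sq_stdGaussian, noiseLaw,
      integral_fun_snd (μ := alphaLaw d p q) (ν := stdGaussian (E d)) fun x => ‖x‖ ^ 2]
    simp
  have e3 : ∫ ω, inner ℝ (v : E d) ω.2 ^ 2 ∂(noiseLaw d p q) = 1 := by
    have := integral_inner_sq_stdGaussian (v : E d)
    rw [noiseLaw, integral_fun_snd (μ := alphaLaw d p q) (ν := stdGaussian (E d))
      fun x => inner ℝ (v : E d) x ^ 2, this]
    simp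
  simp_rw [norm_sq_privUnitGSample]
  rw [integral_const_mul, integral_add h1 h4, integral_const_mul,
    integral_sub h2 h3, e1, e2, e3, unitErr, mConst_eq hd]
  have hs := (sigma_pos hd).ne'
  have hd' : (d : ℝ) ≠ 0 := by positivity
  field_simp
  ring

lemma memLp_two_privUnitGSample (hd : 1 ≤ d) (hp : p ∈ Icc (0 : ℝ) 1) (hq : q ∈ Ioo (0 : ℝ) 1)
    (v : S d) : MemLp (privUnitGSample d p q v) 2 (noiseLaw d p q) := by
  rw [memLp_two_iff_integrable_sq_norm (measurable_privUnitGSample v).aestronglyMeasurable]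
  exact integrable_norm_sq_privUnitGSample hd hp hq v

/-- PrivUnitG is unbiased. -/
lemma integral_privUnitGSample (hd : 1 ≤ d) (hp : p ∈ Icc (0 : ℝ) 1) (hq : q ∈ Ioo (0 : ℝ) 1)
    (v : S d) (hm : signal p q ≠ 0) :
    ∫ ω, privUnitGSample d p q v ω ∂(noiseLaw d p q) = v := by
  have := isProbabilityMeasure_alphaLaw hd hp hq
  have h1 : Integrable (fun ω : ℝ × E d => ω.1) (noiseLaw d p q) :=
    ((memLp_two_alphaLaw hd hq).integrable one_le_two).comp_fst _
  have h0 : Integrable (fun g : E d => g) (stdGaussian (E d)) := IsGaussian.integrable_fun_id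
  have h2 : Integrable (fun ω : ℝ × E d => ω.2) (noiseLaw d p q) := h0.comp_snd _
  have h3 : Integrable (fun ω : ℝ × E d => inner ℝ (v : E d) ω.2 • (v : E d)) (noiseLaw d p q) :=
    (h2.const_inner _).smul_const _
  have h4 : Integrable (fun ω : ℝ × E d => sigma d • (ω.2 - inner ℝ (v : E d) ω.2 • (v : E d)))
      (noiseLaw d p q) := by
    simpa using! (h2.sub h3).smul (sigma d)
  have e1 : ∫ ω, ω.1 ∂(noiseLaw d p q) = mConst d p q := by
    rw [mConst_eq hd, ← integral_id_alphaLaw hd hp hq, noiseLaw,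
      integral_fun_fst (μ := alphaLaw d p q) (ν := stdGaussian (E d)) fun x => x]
    simp
  have e2 : ∫ ω, ω.2 ∂(noiseLaw d p q) = 0 := by
    rw [noiseLaw, integral_fun_snd (μ := alphaLaw d p q) (ν := stdGaussian (E d)) fun x => x]
    simp
  have e3 : ∫ ω, inner ℝ (v : E d) ω.2 ∂(noiseLaw d p q) = 0 := by
    rw [integral_inner h2, e2, inner_zero_right]
  simp only [privUnitGSample]
  rw [integral_smul, integral_add (h1.smul_const _) h4, integral_smul_const, integral_smul,
    integral_sub h2 h3, integral_smul_const, e1, e2, e3]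
  simp [smul_smul, inv_mul_cancel₀ ((mConst_ne_zero_iff hd).2 hm)]

end

/-! ### Differential privacy of PrivUnitG -/

section

variable {d : ℕ} {p q : ℝ}

/-- If `α` is replaced by an unconditioned Gaussian of the same variance, the message becomes an
isotropic Gaussian vector, whatever the input. -/
lemma charFun_map_privUnitGSample (hd : 1 ≤ d) (v : S d) (ξ : E d) :
    charFun (((gaussianReal 0 (1 / (d : ℝ≥0))).prod (stdGaussian (E d))).map
        (privUnitGSample d p q v)) ξ
      = Complex.exp (-((1 / mConst d p q) ^ 2 * sigma d ^ 2 * ‖ξ‖ ^ 2 / 2 : ℝ)) := by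
  set c := 1 / mConst d p q with hc
  set a := inner ℝ (v : E d) ξ with ha
  set u : E d := (c * sigma d) • (ξ - a • (v : E d)) with hu
  have hvv : inner ℝ (v : E d) (v : E d) = 1 := by simp
  have key (ω : ℝ × E d) :
      inner ℝ (privUnitGSample d p q v ω) ξ = inner ℝ ω.1 (c * a) + inner ℝ ω.2 u := by
    simp only [privUnitGSample, inner_add_left, inner_sub_left, inner_smul_left, inner_sub_right,
      inner_smul_right, hu, real_inner_comm (v : E d) ω.2, ← ha, ← hc]
    simp
    ring
  have hun : ‖u‖ ^ 2 = c ^ 2 * sigma d ^ 2 * (‖ξ‖ ^ 2 - a ^ 2) := by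
    rw [hu, norm_smul, mul_pow, Real.norm_eq_abs, sq_abs, mul_pow, norm_sub_sq_real, norm_smul,
      inner_smul_right, real_inner_comm, ← ha, mul_pow, Real.norm_eq_abs, sq_abs,
      norm_eq_of_mem_sphere]
    ring
  rw [charFun_apply, integral_map (measurable_privUnitGSample v).aemeasurable
    (Measurable.aestronglyMeasurable (by fun_prop))]
  simp_rw [key, Complex.ofReal_add, add_mul, Complex.exp_add]
  rw [integral_prod_mul (fun x : ℝ => Complex.exp ((inner ℝ x (c * a) : ℝ) * Complex.I))
    (fun x : E d => Complex.exp ((inner ℝ x u : ℝ) * Complex.I)), ← charFun_apply, ← charFun_apply,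
    charFun_gaussianReal, charFun_stdGaussian, ← Complex.exp_add]
  congr 1
  have hs := sigma_sq hd
  norm_cast
  rw [hun]
  push_cast
  have h2 : ((1 / d : ℝ) : ℂ) = (sigma d : ℂ) ^ 2 := by rw [← hs]; push_cast; rfl
  push_cast at h2
  simp only [h2]
  ring

lemma map_privUnitGSample_eq (hd : 1 ≤ d) (v v' : S d) :
    ((gaussianReal 0 (1 / (d : ℝ≥0))).prod (stdGaussian (E d))).map (privUnitGSample d p q v) =
      ((gaussianReal 0 (1 / (d : ℝ≥0))).prod (stdGaussian (E d))).map
        (privUnitGSample d p q v') := by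
  have := Measure.isProbabilityMeasure_map
    (μ := (gaussianReal 0 (1 / (d : ℝ≥0))).prod (stdGaussian (E d)))
    (measurable_privUnitGSample (p := p) (q := q) v).aemeasurable
  have := Measure.isProbabilityMeasure_map
    (μ := (gaussianReal 0 (1 / (d : ℝ≥0))).prod (stdGaussian (E d)))
    (measurable_privUnitGSample (p := p) (q := q) v').aemeasurable
  refine Measure.ext_of_charFun (funext fun ξ => ?_)
  rw [charFun_map_privUnitGSample hd, charFun_map_privUnitGSample hd]

lemma gaussianReal_one_div_inter_add (s : Set ℝ) :
    gaussianReal 0 (1 / (d : ℝ≥0)) (s ∩ Ici (gam d q)) +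
      gaussianReal 0 (1 / (d : ℝ≥0)) (s ∩ Iio (gam d q)) = gaussianReal 0 (1 / (d : ℝ≥0)) s := by
  rw [← measure_inter_add_sdiff s (measurableSet_Ici (a := gam d q)), sdiff_eq, compl_Ici]

lemma alphaLaw_le (hd : 1 ≤ d) (hq : q ∈ Ioo (0 : ℝ) 1) :
    alphaLaw d p q ≤
      ENNReal.ofReal (max (p / (1 - q)) ((1 - p) / q)) • gaussianReal 0 (1 / (d : ℝ≥0)) := by
  refine Measure.le_iff.2 fun s hs => ?_
  rw [alphaLaw_apply hd hq hs, Measure.smul_apply, smul_eq_mul,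
    ← gaussianReal_one_div_inter_add (q := q) s, mul_add]
  gcongr
  · exact le_max_left _ _
  · exact le_max_right _ _

lemma le_alphaLaw (hd : 1 ≤ d) (hq : q ∈ Ioo (0 : ℝ) 1) :
    ENNReal.ofReal (min (p / (1 - q)) ((1 - p) / q)) • gaussianReal 0 (1 / (d : ℝ≥0)) ≤
      alphaLaw d p q := by
  refine Measure.le_iff.2 fun s hs => ?_
  rw [alphaLaw_apply hd hq hs, Measure.smul_apply, smul_eq_mul,
    ← gaussianReal_one_div_inter_add (q := q) s, mul_add]
  gcongr
  · exact min_le_left _ _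
  · exact min_le_right _ _

lemma isDP_privUnitG {ε : ℝ} (hd : 1 ≤ d) (hp : p ∈ Icc (0 : ℝ) 1) (hq : q ∈ Ioo (0 : ℝ) 1)
    (hε : 0 ≤ ε) (h1 : p / (1 - q) ≤ Real.exp ε * ((1 - p) / q))
    (h2 : (1 - p) / q ≤ Real.exp ε * (p / (1 - q))) : IsDP ε (privUnitG d p q) := by
  have := isProbabilityMeasure_alphaLaw hd hp hq
  have hw1 : 0 ≤ p / (1 - q) := div_nonneg hp.1 (by linarith [hq.2])
  have hw2 : 0 ≤ (1 - p) / q := div_nonneg (by linarith [hp.2]) hq.1.le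
  have he := Real.one_le_exp hε
  have hw : max (p / (1 - q)) ((1 - p) / q) ≤
      Real.exp ε * min (p / (1 - q)) ((1 - p) / q) := by
    rcases le_total (p / (1 - q)) ((1 - p) / q) with h | h <;> simp [h, h1, h2]
  intro v v' T hT
  have hup : privUnitG d p q v ≤ ENNReal.ofReal (max (p / (1 - q)) ((1 - p) / q)) •
      ((gaussianReal 0 (1 / (d : ℝ≥0))).prod (stdGaussian (E d))).map
        (privUnitGSample d p q v) := by
    rw [privUnitG, noiseLaw, ← Measure.map_smul, ← Measure.prod_smul_left]
    exact Measure.map_mono (Measure.prod_mono (alphaLaw_le hd hq) le_rfl)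
      (measurable_privUnitGSample v)
  have hlow : ENNReal.ofReal (min (p / (1 - q)) ((1 - p) / q)) •
      ((gaussianReal 0 (1 / (d : ℝ≥0))).prod (stdGaussian (E d))).map
        (privUnitGSample d p q v) ≤ privUnitG d p q v' := by
    rw [map_privUnitGSample_eq hd v v', privUnitG, noiseLaw, ← Measure.map_smul,
      ← Measure.prod_smul_left]
    exact Measure.map_mono (Measure.prod_mono (le_alphaLaw hd hq) le_rfl)
      (measurable_privUnitGSample v')
  refine (hup T).trans (le_trans ?_ (mul_le_mul_right (hlow T) _))
  rw [Measure.smul_apply, Measure.smul_apply, smul_eq_mul, smul_eq_mul, ← mul_assoc,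
    ← ENNReal.ofReal_mul (Real.exp_pos ε).le]
  gcongr

lemma inner_mConst_smul_privUnitGSample (hm : mConst d p q ≠ 0) (v : S d) (ω : ℝ × E d) :
    inner ℝ (v : E d) (mConst d p q • privUnitGSample d p q v ω) = ω.1 := by
  rw [privUnitGSample, smul_smul, mul_one_div_cancel hm, one_smul]
  simp [inner_add_right, inner_sub_right, inner_smul_right]

/-- On the half-space `⟨v, m y⟩ > |γ|` the density of the message is proportional to `p / (1 - q)`
for the input `v` and to `(1 - p) / q` for the input `-v`, so that privacy bounds the ratio of the
two weights. -/
lemma weights_le_of_isDP {ε : ℝ} (hd : 1 ≤ d) (hp : p ∈ Icc (0 : ℝ) 1) (hq : q ∈ Ioo (0 : ℝ) 1)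
    (hm : mConst d p q ≠ 0) (h : IsDP ε (privUnitG d p q)) :
    p / (1 - q) ≤ Real.exp ε * ((1 - p) / q) ∧ (1 - p) / q ≤ Real.exp ε * (p / (1 - q)) := by
  have := isProbabilityMeasure_alphaLaw hd hp hq
  have hw1 : 0 ≤ p / (1 - q) := div_nonneg hp.1 (by linarith [hq.2])
  have hw2 : 0 ≤ (1 - p) / q := div_nonneg (by linarith [hp.2]) hq.1.le
  obtain ⟨v⟩ := nonempty_sphere hd
  set N := gaussianReal 0 (1 / (d : ℝ≥0)) with hN
  set r := |gam d q|
  set T : Set (E d) := {y | r < inner ℝ (v : E d) (mConst d p q • y)}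
  have hT : MeasurableSet T :=
    measurableSet_lt measurable_const (Measurable.inner measurable_const (by fun_prop))
  have hd0 : (1 / (d : ℝ≥0)) ≠ 0 := by simp; omega
  have hsymm : N (Iio (-r)) = N (Ioi r) := by
    have h : N.map (fun x => -x) = N := by simpa using gaussianReal_map_neg (μ := 0)
    conv_lhs => rw [← h]
    rw [Measure.map_apply measurable_neg measurableSet_Iio]
    congr 1
    ext x
    simp
  have hpos : N (Ioi r) ≠ 0 := by
    have : N.IsOpenPosMeasure := (gaussianReal_absolutelyContinuous' 0 hd0).isOpenPosMeasure
    exact (isOpen_Ioi.measure_pos _ nonempty_Ioi).ne'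
  have e1 : privUnitG d p q v T = ENNReal.ofReal (p / (1 - q)) * N (Ioi r) := by
    have hpre : privUnitGSample d p q v ⁻¹' T = Ioi r ×ˢ univ := by
      ext ω
      simp [T, inner_mConst_smul_privUnitGSample hm]
    have hdisj : Ioi r ∩ Iio (gam d q) = ∅ :=
      eq_empty_of_forall_notMem fun x hx =>
        absurd (le_abs_self (gam d q)) (not_le.2 (hx.2.trans' hx.1))
    rw [privUnitG, Measure.map_apply (measurable_privUnitGSample v) hT, hpre, noiseLaw,
      Measure.prod_prod, measure_univ, mul_one, alphaLaw_apply hd hq measurableSet_Ioi,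
      inter_eq_left.2 (Ioi_subset_Ici (le_abs_self _)), hdisj,
      measure_empty, mul_zero, add_zero]
  have e2 : privUnitG d p q (-v) T = ENNReal.ofReal ((1 - p) / q) * N (Ioi r) := by
    have hpre : privUnitGSample d p q (-v) ⁻¹' T = Iio (-r) ×ˢ univ := by
      ext ω
      have := inner_mConst_smul_privUnitGSample hm (-v) ω
      rw [show ((-v : S d) : E d) = -(v : E d) from rfl, inner_neg_left,
        neg_eq_iff_eq_neg] at this
      simp [T, this, lt_neg]
    have hdisj : Iio (-r) ∩ Ici (gam d q) = ∅ :=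
      eq_empty_of_forall_notMem fun x hx =>
        absurd (neg_abs_le (gam d q)) (not_le.2 (hx.1.trans_le' hx.2))
    rw [privUnitG, Measure.map_apply (measurable_privUnitGSample _) hT, hpre, noiseLaw,
      Measure.prod_prod, measure_univ, mul_one, alphaLaw_apply hd hq measurableSet_Iio,
      inter_eq_left.2 (Iio_subset_Iio (neg_abs_le _)), hdisj,
      measure_empty, mul_zero, zero_add, hsymm]
  have h1 := h v (-v) T hT
  have h2 := h (-v) v T hT
  rw [e1, e2, ← mul_assoc, ENNReal.mul_le_mul_iff_left hpos (measure_ne_top _ _),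
    ← ENNReal.ofReal_mul (Real.exp_pos ε).le,
    ENNReal.ofReal_le_ofReal_iff (by positivity)] at h1 h2
  exact ⟨h1, h2⟩

/-- Admissibility does not depend on the dimension: it says that the signal is nonzero and that the
two weights are within a factor `e ^ ε` of each other. -/
lemma admissible_iff {ε : ℝ} (hd : 1 ≤ d) (hε : 0 ≤ ε) :
    Admissible d ε p q ↔ p ∈ Icc (0 : ℝ) 1 ∧ q ∈ Ioo (0 : ℝ) 1 ∧ signal p q ≠ 0 ∧
      p / (1 - q) ≤ Real.exp ε * ((1 - p) / q) ∧ (1 - p) / q ≤ Real.exp ε * (p / (1 - q)) := by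
  constructor
  · rintro ⟨hp, hq, hm, h⟩
    exact ⟨hp, hq, (mConst_ne_zero_iff hd).1 hm, weights_le_of_isDP hd hp hq hm h⟩
  · rintro ⟨hp, hq, hm, h1, h2⟩
    exact ⟨hp, hq, (mConst_ne_zero_iff hd).2 hm, isDP_privUnitG hd hp hq hε h1 h2⟩

end

/-! ### Mean squared error of an average of independent messages -/

section

variable {n d : ℕ} {Y : Type*} [MeasurableSpace Y]

/-- Bias-variance decomposition of the average of independent vectors `f yᵢ`, where `yᵢ` has law
`ρ i`. -/
lemma lintegral_norm_average_sub_sq (ρ : Fin n → Measure Y) [∀ i, IsProbabilityMeasure (ρ i)]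
    {f : Y → E d} (hf : ∀ i, MemLp f 2 (ρ i)) (c : E d) :
    ∫⁻ y, ENNReal.ofReal (‖(n : ℝ)⁻¹ • ∑ i, f (y i) - c‖ ^ 2) ∂(Measure.pi ρ) =
      ENNReal.ofReal ((n : ℝ)⁻¹ ^ 2 * ∑ i, (∫ y, ‖f y‖ ^ 2 ∂(ρ i) - ‖∫ y, f y ∂(ρ i)‖ ^ 2) +
        ‖(n : ℝ)⁻¹ • ∑ i, ∫ y, f y ∂(ρ i) - c‖ ^ 2) := by
  -- the coordinates of the average and their moments
  have hfl (i : Fin n) (l : Fin d) : MemLp (fun y => f y l) 2 (ρ i) :=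
    (EuclideanSpace.proj (𝕜 := ℝ) l).comp_memLp' (hf i)
  have hpi (i : Fin n) (l : Fin d) :
      MemLp (fun y : Fin n → Y => f (y i) l) 2 (Measure.pi ρ) :=
    (hfl i l).comp_measurePreserving (measurePreserving_eval ρ i)
  have hsum (l : Fin d) :
      MemLp (∑ i, fun y : Fin n → Y => f (y i) l) 2 (Measure.pi ρ) :=
    memLp_finsetSum' _ fun i _ => hpi i l
  have hmean (i : Fin n) (l : Fin d) : ∫ y, f y l ∂(ρ i) = (∫ y, f y ∂(ρ i)) l :=
    (EuclideanSpace.proj (𝕜 := ℝ) l).integral_comp_comm ((hf i).integrable one_le_two)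
  have hdev (l : Fin d) : MemLp (fun y : Fin n → Y =>
      (n : ℝ)⁻¹ * (∑ i, fun y : Fin n → Y => f (y i) l) y - c l) 2 (Measure.pi ρ) :=
    ((hsum l).const_mul _).sub (memLp_const _)
  have hcoord (l : Fin d) :
      ∫ y, ((n : ℝ)⁻¹ * (∑ i, fun y : Fin n → Y => f (y i) l) y - c l) ^ 2 ∂(Measure.pi ρ) =
        (n : ℝ)⁻¹ ^ 2 * ∑ i, (∫ y, f y l ^ 2 ∂(ρ i) - (∫ y, f y ∂(ρ i)) l ^ 2) +
          ((n : ℝ)⁻¹ * ∑ i, (∫ y, f y ∂(ρ i)) l - c l) ^ 2 := by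
    have h1 := variance_eq_sub (hdev l)
    rw [variance_sub_const (by exact ((hsum l).const_mul _).aestronglyMeasurable),
      variance_const_mul, variance_sum_pi fun i => hfl i l] at h1
    have h2 (i : Fin n) : Var[fun y => f y l; ρ i] =
        ∫ y, f y l ^ 2 ∂(ρ i) - (∫ y, f y ∂(ρ i)) l ^ 2 := by
      rw [variance_eq_sub (hfl i l), hmean]
      rfl
    have h3 : ∫ y, ((n : ℝ)⁻¹ * (∑ i, fun y : Fin n → Y => f (y i) l) y - c l) ∂(Measure.pi ρ) =
        (n : ℝ)⁻¹ * ∑ i, (∫ y, f y ∂(ρ i)) l - c l := by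
      rw [integral_sub (((hsum l).integrable one_le_two).const_mul _) (integrable_const _),
        integral_const_mul]
      simp only [Finset.sum_apply]
      rw [integral_finsetSum _ fun i _ => (hpi i l).integrable one_le_two]
      simp_rw [← hmean]
      simp only [integral_const, probReal_univ, one_smul]
      congr 3 with i
      exact integral_comp_eval (μ := ρ) (i := i) (f := fun y => f y l)
        (hfl i l).aestronglyMeasurable
    simp only [h2, h3, Pi.pow_apply] at h1
    linarith
  have hnorm (y : Fin n → Y) : ‖(n : ℝ)⁻¹ • ∑ i, f (y i) - c‖ ^ 2 =
      ∑ l, ((n : ℝ)⁻¹ * (∑ i, fun y : Fin n → Y => f (y i) l) y - c l) ^ 2 := by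
    simp [EuclideanSpace.real_norm_sq_eq]
  simp_rw [hnorm]
  rw [← ofReal_integral_eq_lintegral_ofReal
    (integrable_finsetSum _ fun l _ => (hdev l).integrable_sq)
    (.of_forall fun y => Finset.sum_nonneg fun l _ => sq_nonneg _),
    integral_finsetSum _ fun l _ => (hdev l).integrable_sq]
  congr 1
  simp_rw [hcoord, EuclideanSpace.real_norm_sq_eq]
  rw [Finset.sum_add_distrib, ← Finset.mul_sum, Finset.sum_comm]
  congr 2
  · refine Finset.sum_congr rfl fun i _ => ?_
    rw [integral_finsetSum _ fun l _ => (hfl i l).integrable_sq, Finset.sum_sub_distrib]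
  · simp

end

section

variable {n d : ℕ} {p q : ℝ}

lemma mse_privUnitG (hd : 1 ≤ d) (hp : p ∈ Icc (0 : ℝ) 1) (hq : q ∈ Ioo (0 : ℝ) 1)
    (hm : signal p q ≠ 0) (v : Fin n → S d) :
    mse average (privUnitG d p q) v = ENNReal.ofReal ((n : ℝ)⁻¹ * unitErr d p q) := by
  have := isProbabilityMeasure_noiseLaw hd hp hq
  have (x : S d) : IsProbabilityMeasure (privUnitG d p q x) :=
    Measure.isProbabilityMeasure_map (measurable_privUnitGSample x).aemeasurable
  have hL (x : S d) : MemLp (fun y : E d => y) 2 (privUnitG d p q x) :=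
    (memLp_map_measure_iff aestronglyMeasurable_id
      (measurable_privUnitGSample x).aemeasurable).2 (memLp_two_privUnitGSample hd hp hq x)
  have e1 (x : S d) : ∫ y, y ∂(privUnitG d p q x) = x := by
    rw [privUnitG, integral_map (measurable_privUnitGSample x).aemeasurable
      (by fun_prop), integral_privUnitGSample hd hp hq x hm]
  have e2 (x : S d) : ∫ y, ‖y‖ ^ 2 ∂(privUnitG d p q x) = unitErr d p q + 1 := by
    rw [privUnitG, integral_map (measurable_privUnitGSample x).aemeasurable
      (by fun_prop), integral_norm_sq_privUnitGSample hd hp hq x hm]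
  have h := lintegral_norm_average_sub_sq (fun i => privUnitG d p q (v i)) (fun i => hL (v i))
    ((n : ℝ)⁻¹ • ∑ i, (v i : E d))
  rw [mse]
  simp only [average]
  rw [h]
  simp only [e1, e2]
  congr 1
  rcases eq_or_ne n 0 with rfl | hn
  · simp
  · simp
    field_simp

lemma errPrivUnitG_eq (hd : 1 ≤ d) (hp : p ∈ Icc (0 : ℝ) 1) (hq : q ∈ Ioo (0 : ℝ) 1)
    (hm : signal p q ≠ 0) :
    errPrivUnitG n d p q = ENNReal.ofReal ((n : ℝ)⁻¹ * unitErr d p q) := by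
  have := nonempty_sphere hd
  simp [errPrivUnitG, err, mse_privUnitG hd hp hq hm]

lemma unitErr_ge (d : ℕ) (hp : p ∈ Icc (0 : ℝ) 1) (hq : q ∈ Ioo (0 : ℝ) 1)
    (hm : signal p q ≠ 0) : ((d : ℝ) - 1) / signal p q ^ 2 ≤ unitErr d p q := by
  have h := signal_sq_le hp hq
  rw [unitErr, div_le_iff₀ (by positivity), sub_mul, div_mul_cancel₀ _ (by positivity)]
  linarith

end

/-! ### Size of the signal under privacy -/

section

variable {d : ℕ} {p q ε : ℝ}

/-- The weights average to `1` under the Gaussian law, which gives mass `1 - q` to the side above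
the threshold and `q` to the side below it. -/
lemma weights_average (hq : q ∈ Ioo (0 : ℝ) 1) :
    p / (1 - q) * (1 - q) + (1 - p) / q * q = 1 := by
  rw [div_mul_cancel₀ _ (by linarith [hq.2]), div_mul_cancel₀ _ hq.1.ne']
  ring

lemma abs_mul_exp_neg_sq_div_le (t : ℝ) : |t| * Real.exp (-(t ^ 2 / 4)) ≤ 1 := by
  have h := Real.add_one_le_exp (t ^ 2 / 4)
  have h2 : |t| ≤ t ^ 2 / 4 + 1 := by nlinarith [sq_nonneg (|t| - 2), sq_abs t]
  calc |t| * Real.exp (-(t ^ 2 / 4))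
      ≤ Real.exp (t ^ 2 / 4) * Real.exp (-(t ^ 2 / 4)) := by gcongr; linarith
    _ = 1 := by rw [← Real.exp_add]; simp

lemma abs_signal_le (hq : q ∈ Ioo (0 : ℝ) 1)
    (h1 : p / (1 - q) ≤ Real.exp ε * ((1 - p) / q))
    (h2 : (1 - p) / q ≤ Real.exp ε * (p / (1 - q))) (hε : 0 < ε) :
    |signal p q| ≤ gaussianPDFReal 0 1 (normalQuantile q) * (Real.exp ε - 1) := by
  have h := weights_average (p := p) hq
  have he := Real.one_le_exp hε.le
  have hq1 : 0 < 1 - q := by linarith [hq.2]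
  rw [signal, abs_mul, abs_of_pos (gaussianPDFReal_zero_one_pos _)]
  refine mul_le_mul_of_nonneg_left ?_ (gaussianPDFReal_zero_one_pos _).le
  set a := p / (1 - q)
  set b := (1 - p) / q
  -- the smaller of the two weights is at most their average `1`
  rcases le_total a b with hab | hab
  · have ha : a ≤ 1 := by nlinarith [hq.1]
    rw [abs_of_nonpos (by linarith)]
    nlinarith
  · have hb : b ≤ 1 := by nlinarith [hq.1]
    rw [abs_of_nonneg (by linarith)]
    nlinarith

/-- For `ε ≤ 1` this comes from `|M| ≤ φ(t) (e ^ ε - 1)` and the boundedness of `|t| φ(t)`; for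
`ε ≥ 1`, from `M² ≤ 1 + t M` when `t² ≤ 4 ε` and from the Gaussian tail otherwise. -/
lemma quantile_mul_signal_le (hp : p ∈ Icc (0 : ℝ) 1) (hq : q ∈ Ioo (0 : ℝ) 1)
    (h1 : p / (1 - q) ≤ Real.exp ε * ((1 - p) / q))
    (h2 : (1 - p) / q ≤ Real.exp ε * (p / (1 - q))) (hε : 0 < ε) :
    normalQuantile q * signal p q ≤ 5 * ε := by
  have hM := abs_signal_le hq h1 h2 hε
  have hv := signal_sq_le hp hq
  set t := normalQuantile q
  set M := signal p q
  have hφ := gaussianPDFReal_zero_one_le t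
  have he := Real.one_le_exp hε.le
  have htM : t * M ≤ |t| * (1 / 2 * Real.exp (-t ^ 2 / 2) * (Real.exp ε - 1)) := by
    refine (le_abs_self _).trans ?_
    rw [abs_mul]
    gcongr
    exact hM.trans (by gcongr)
  have ht := abs_mul_exp_neg_sq_div_le t
  rcases le_total ε 1 with h | h
  · have h3 : Real.exp ε - 1 ≤ 2 * ε := by
      have := Real.abs_exp_sub_one_le (x := ε) (by rwa [abs_of_pos hε])
      rw [abs_of_pos hε] at this
      exact (le_abs_self _).trans this
    have h4 : Real.exp (-t ^ 2 / 2) ≤ Real.exp (-(t ^ 2 / 4)) :=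
      Real.exp_le_exp.2 (by nlinarith [sq_nonneg t])
    have h5 : |t| * Real.exp (-t ^ 2 / 2) ≤ 1 :=
      (mul_le_mul_of_nonneg_left h4 (abs_nonneg t)).trans ht
    nlinarith
  · rcases le_total (t ^ 2) (4 * ε) with h3 | h3
    · -- `y = t M` satisfies `y ^ 2 ≤ t ^ 2 (1 + y)`, hence `y ≤ t ^ 2 + 1`
      have h4 : (t * M) ^ 2 ≤ t ^ 2 * (1 + t * M) := by
        rw [mul_pow]
        gcongr
      have h5 : t * M ≤ t ^ 2 + 1 := by
        by_contra! hc
        nlinarith [sq_nonneg t]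
      linarith
    · -- far in the tail, the decay of the Gaussian density beats the factor `e ^ ε`
      have h4 : Real.exp (-t ^ 2 / 2) * Real.exp ε ≤ Real.exp (-(t ^ 2 / 4)) := by
        rw [← Real.exp_add]
        exact Real.exp_le_exp.2 (by linarith)
      have h5 : Real.exp (-t ^ 2 / 2) * (Real.exp ε - 1) ≤ Real.exp (-(t ^ 2 / 4)) := by
        nlinarith [Real.exp_pos (-t ^ 2 / 2)]
      have h6 := (mul_le_mul_of_nonneg_left h5 (abs_nonneg t)).trans ht
      nlinarith

/-- For `ε ≤ 1` the bound on `|M|` suffices; for `ε ≥ 1`, `M² ≤ 1 + t M ≤ 1 + 5 ε`. -/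
lemma signal_sq_le_of_private (hp : p ∈ Icc (0 : ℝ) 1) (hq : q ∈ Ioo (0 : ℝ) 1)
    (h1 : p / (1 - q) ≤ Real.exp ε * ((1 - p) / q))
    (h2 : (1 - p) / q ≤ Real.exp ε * (p / (1 - q))) (hε : 0 < ε) :
    signal p q ^ 2 ≤ 6 * ε := by
  rcases le_total ε 1 with h | h
  · have hM := abs_signal_le hq h1 h2 hε
    have h3 : Real.exp ε - 1 ≤ 2 * ε := by
      have := Real.abs_exp_sub_one_le (x := ε) (by rwa [abs_of_pos hε])
      rw [abs_of_pos hε] at this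
      exact (le_abs_self _).trans this
    have h4 : gaussianPDFReal 0 1 (normalQuantile q) ≤ 1 / 2 := by
      refine (gaussianPDFReal_zero_one_le _).trans ?_
      have : Real.exp (-normalQuantile q ^ 2 / 2) ≤ 1 :=
        Real.exp_le_one_iff.2 (by nlinarith [sq_nonneg (normalQuantile q)])
      linarith
    have h5 : |signal p q| ≤ ε := by
      nlinarith [Real.one_le_exp hε.le, gaussianPDFReal_zero_one_pos (normalQuantile q)]
    rw [← sq_abs]
    nlinarith [abs_nonneg (signal p q)]
  · linarith [signal_sq_le hp hq, quantile_mul_signal_le hp hq h1 h2 hε]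

/-- The comparison of the errors of PrivUnitG in dimensions `k ≤ d` with the same parameters. -/
lemma div_mul_unitErr_add_one_le {k : ℕ} (hk : 1 ≤ k) (hkd : k ≤ d) (hd : 2 ≤ d)
    (hε : 0 < ε) (h : Admissible d ε p q) :
    (d : ℝ) / k * (unitErr k p q + 1) ≤ unitErr d p q * (1 + 22 * (ε / k)) := by
  obtain ⟨hp, hq, hm, h1, h2⟩ := (admissible_iff (by omega) hε.le).1 h
  have hge := unitErr_ge d hp hq hm
  have hy := quantile_mul_signal_le hp hq h1 h2 hε
  have hM := signal_sq_le_of_private hp hq h1 h2 hε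
  have hk0 : (0 : ℝ) < k := by exact_mod_cast hk
  have hd0 : (2 : ℝ) ≤ d := by exact_mod_cast hd
  have hkd' : (1 : ℝ) ≤ d / k := by
    rw [one_le_div hk0]
    exact_mod_cast hkd
  have hM0 : 0 < signal p q ^ 2 := by positivity
  set r : ℝ := d / k with hr
  have e1 : r * (unitErr k p q + 1) - unitErr d p q =
      ((r - 1) * (normalQuantile q * signal p q) + signal p q ^ 2) / signal p q ^ 2 := by
    rw [unitErr, unitErr, hr]
    field_simp
    ring
  have e2 : ((r - 1) * (normalQuantile q * signal p q) + signal p q ^ 2) / signal p q ^ 2 ≤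
      (r * (11 * ε)) / signal p q ^ 2 := by
    gcongr
    nlinarith
  have e3 : (r * (11 * ε)) / signal p q ^ 2 ≤
      (((d : ℝ) - 1) / signal p q ^ 2) * (22 * (ε / k)) := by
    rw [div_mul_eq_mul_div ((d : ℝ) - 1)]
    have h0 : 0 < ε / k := by positivity
    refine div_le_div_of_nonneg_right ?_ hM0.le
    have : r * (11 * ε) = d * (11 * (ε / k)) := by
      rw [hr]
      field_simp
    rw [this]
    nlinarith
  have e4 : (((d : ℝ) - 1) / signal p q ^ 2) * (22 * (ε / k)) ≤
      unitErr d p q * (22 * (ε / k)) := mul_le_mul_of_nonneg_right hge (by positivity)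
  linarith

end

/-! ### Existence of optimized parameters -/

/-- The largest signal compatible with `ε`-differential privacy when the threshold is at `t`. -/
noncomputable def maxSignal (ε t : ℝ) : ℝ :=
  gaussianPDFReal 0 1 t * ((Real.exp ε - 1) /
    (Real.exp ε * (1 - cdf (gaussianReal 0 1) t) + cdf (gaussianReal 0 1) t))

section

variable {d : ℕ} {p q ε : ℝ}

lemma one_le_maxSignal_denom (hε : 0 ≤ ε) (t : ℝ) :
    1 ≤ Real.exp ε * (1 - cdf (gaussianReal 0 1) t) + cdf (gaussianReal 0 1) t := by
  nlinarith [Real.one_le_exp hε, cdf_gaussianReal_lt_one t]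

lemma maxSignal_pos (hε : 0 < ε) (t : ℝ) : 0 < maxSignal ε t :=
  mul_pos (gaussianPDFReal_zero_one_pos t)
    (div_pos (by linarith [Real.one_lt_exp_iff.2 hε])
      (by linarith [one_le_maxSignal_denom hε.le t]))

lemma maxSignal_le (hε : 0 < ε) (t : ℝ) :
    maxSignal ε t ≤ gaussianPDFReal 0 1 t * (Real.exp ε - 1) := by
  refine mul_le_mul_of_nonneg_left ?_ (gaussianPDFReal_zero_one_pos t).le
  exact div_le_self (by linarith [Real.one_lt_exp_iff.2 hε]) (one_le_maxSignal_denom hε.le t)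

lemma continuous_gaussianPDFReal_zero_one : Continuous (gaussianPDFReal 0 1) :=
  continuous_iff_continuousAt.2 fun x => (hasDerivAt_gaussianPDFReal_zero_one x).continuousAt

lemma continuous_maxSignal (hε : 0 < ε) : Continuous (maxSignal ε) := by
  have h1 := continuous_gaussianPDFReal_zero_one
  have h2 := continuous_cdf_gaussianReal
  unfold maxSignal
  refine h1.mul (continuous_const.div (by fun_prop) fun t => ?_)
  linarith [one_le_maxSignal_denom hε.le t]

lemma tendsto_maxSignal (hε : 0 < ε) :
    Tendsto (maxSignal ε) (cocompact ℝ) (𝓝 0) ∧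
      Tendsto (fun t => t * maxSignal ε t) (cocompact ℝ) (𝓝 0) := by
  have ha : Tendsto (fun t : ℝ => |t|) (cocompact ℝ) atTop := tendsto_norm_cocompact_atTop
  have hφ (t : ℝ) : gaussianPDFReal 0 1 |t| = gaussianPDFReal 0 1 t := by
    rcases abs_choice t with h | h <;> simp [h, gaussianPDFReal_zero_one_neg]
  constructor
  · have h := ((tendsto_gaussianPDFReal_zero_one_atTop.1.comp ha).mul_const (Real.exp ε - 1))
    rw [zero_mul] at h
    refine squeeze_zero (fun t => (maxSignal_pos hε t).le) (fun t => ?_) h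
    simpa [hφ] using maxSignal_le hε t
  · have h := ((tendsto_gaussianPDFReal_zero_one_atTop.2.comp ha).mul_const (Real.exp ε - 1))
    rw [zero_mul] at h
    refine squeeze_zero_norm (fun t => ?_) h
    rw [Real.norm_eq_abs, abs_mul, abs_of_pos (maxSignal_pos hε t)]
    simp only [Function.comp_apply, hφ, mul_assoc]
    exact mul_le_mul_of_nonneg_left (maxSignal_le hε t) (abs_nonneg t)

/-- The error for the largest signal at threshold `t` attains its minimum over `t`, since the
signal decays faster than `1 / t`. -/
lemma exists_min_maxSignal (hd : 1 ≤ d) (hε : 0 < ε) : ∃ t : ℝ, ∀ s : ℝ,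
    (d + t * maxSignal ε t) / maxSignal ε t ^ 2 ≤ (d + s * maxSignal ε s) / maxSignal ε s ^ 2 := by
  have hc := continuous_maxSignal hε
  refine Continuous.exists_forall_le (β := ℝ) ?_ ?_
  · exact (continuous_const.add (continuous_id.mul hc)).div (hc.pow 2) fun t =>
      pow_ne_zero 2 (maxSignal_pos hε t).ne'
  · have hd' : (0 : ℝ) < d := by exact_mod_cast hd
    have h1 : Tendsto (fun t => (d : ℝ) + t * maxSignal ε t) (cocompact ℝ) (𝓝 (d : ℝ)) := by
      simpa using (tendsto_maxSignal hε).2.const_add (d : ℝ)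
    have h2 : Tendsto (fun t => maxSignal ε t ^ 2) (cocompact ℝ) (𝓝[>] 0) := by
      refine tendsto_nhdsWithin_iff.2 ⟨by simpa using (tendsto_maxSignal hε).1.pow 2, ?_⟩
      exact .of_forall fun t => pow_pos (maxSignal_pos hε t) 2
    exact h1.pos_mul_atTop hd' (tendsto_inv_nhdsGT_zero.comp h2)

/-- For each threshold there are admissible parameters that attain the largest signal: those for
which the ratio of the two weights is exactly `e ^ ε`. -/
lemma exists_admissible_signal_eq (hε : 0 < ε) (t : ℝ) :
    ∃ p q : ℝ, normalQuantile q = t ∧ signal p q = maxSignal ε t ∧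
      ∀ d : ℕ, 1 ≤ d → Admissible d ε p q := by
  have hq0 := cdf_gaussianReal_pos t
  have hq1 := cdf_gaussianReal_lt_one t
  have hD := one_le_maxSignal_denom hε.le t
  have hqt := normalQuantile_cdf t
  have hpos := maxSignal_pos hε t
  have he := Real.one_lt_exp_iff.2 hε
  rw [maxSignal] at hpos ⊢
  set q := cdf (gaussianReal 0 1) t
  set D := Real.exp ε * (1 - q) + q with hDdef
  have hD0 : 0 < D := by linarith
  have hq1' : 0 < 1 - q := by linarith
  have ha : Real.exp ε * (1 - q) / D / (1 - q) = Real.exp ε / D := by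
    field_simp
  have hb : (1 - Real.exp ε * (1 - q) / D) / q = 1 / D := by
    field_simp
    rw [hDdef]
    ring
  have hs : signal (Real.exp ε * (1 - q) / D) q =
      gaussianPDFReal 0 1 t * ((Real.exp ε - 1) / D) := by
    rw [signal, ha, hb, hqt]
    ring
  refine ⟨Real.exp ε * (1 - q) / D, q, hqt, hs, fun d hd => ?_⟩
  rw [admissible_iff hd hε.le, ha, hb, hs]
  refine ⟨⟨by positivity, (div_le_one hD0).2 (by linarith)⟩, ⟨hq0, hq1⟩, hpos.ne', ?_, ?_⟩
  · rw [mul_one_div]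
  · rw [← mul_div_assoc]
    gcongr
    nlinarith

/-- The error is a decreasing function of the signal. -/
lemma error_antitone_signal {D t M G : ℝ} (hD : 1 ≤ D) (hM : 0 < M) (hMG : M ≤ G)
    (hG : G ^ 2 ≤ 1 + t * G) : (D + t * G) / G ^ 2 ≤ (D + t * M) / M ^ 2 := by
  have hG0 : 0 < G := hM.trans_le hMG
  rw [div_le_div_iff₀ (by positivity) (by positivity)]
  have h1 : 0 ≤ D * (G + M) + M * (t * G) := by
    have : -1 ≤ t * G := by nlinarith [sq_nonneg G]
    nlinarith
  nlinarith [mul_nonneg (sub_nonneg.2 hMG) h1]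

lemma sub_le_div_of_ratio {a b e q : ℝ} (he : 1 ≤ e) (hq : q ∈ Ioo (0 : ℝ) 1)
    (h : a * (1 - q) + b * q = 1) (hab : a ≤ e * b) : a - b ≤ (e - 1) / (e * (1 - q) + q) := by
  rw [le_div_iff₀ (by nlinarith [hq.1, hq.2])]
  have : e - 1 = (e - 1) * (a * (1 - q) + b * q) := by rw [h, mul_one]
  rw [this]
  nlinarith

/-- Admissible parameters are no better than the largest signal at one of the thresholds `t` and
`-t`, where `t = Φ⁻¹(q)`; the second case is reduced to the first by reflection. -/
lemma exists_maxSignal_le_unitErr (hd : 1 ≤ d) (hε : 0 < ε) (h : Admissible d ε p q) :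
    ∃ s : ℝ, (d + s * maxSignal ε s) / maxSignal ε s ^ 2 - 1 ≤ unitErr d p q := by
  obtain ⟨hp, hq, hm, h1, h2⟩ := (admissible_iff hd hε.le).1 h
  have hd' : (1 : ℝ) ≤ d := by exact_mod_cast hd
  have he := Real.one_le_exp hε.le
  have hav := weights_average (p := p) hq
  have hG (s : ℝ) : maxSignal ε s ^ 2 ≤ 1 + s * maxSignal ε s := by
    obtain ⟨p', q', hq', hs, had⟩ := exists_admissible_signal_eq hε s
    rw [← hs, ← hq']
    exact signal_sq_le (had 1 le_rfl).p_mem (had 1 le_rfl).q_mem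
  have hcdf := cdf_normalQuantile hq
  have hφ := gaussianPDFReal_zero_one_pos (normalQuantile q)
  rcases hm.lt_or_gt with hneg | hpos
  · refine ⟨-normalQuantile q, ?_⟩
    have hle : -signal p q ≤ maxSignal ε (-normalQuantile q) := by
      rw [maxSignal, cdf_gaussianReal_neg, hcdf, gaussianPDFReal_zero_one_neg, signal, ← mul_neg,
        neg_sub]
      refine mul_le_mul_of_nonneg_left ?_ hφ.le
      exact sub_le_div_of_ratio (q := 1 - q) he ⟨by linarith [hq.2], by linarith [hq.1]⟩
        (by linarith) h2
    have := error_antitone_signal hd' (by linarith) hle (hG _)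
    rw [neg_mul_neg, neg_sq] at this
    rw [unitErr]
    linarith
  · refine ⟨normalQuantile q, ?_⟩
    have hle : signal p q ≤ maxSignal ε (normalQuantile q) := by
      rw [maxSignal, hcdf, signal]
      exact mul_le_mul_of_nonneg_left (sub_le_div_of_ratio he hq hav h1) hφ.le
    have := error_antitone_signal hd' hpos hle (hG _)
    rw [unitErr]
    linarith

lemma errPrivUnitG_of_admissible (hd : 1 ≤ d) (n : ℕ) (h : Admissible d ε p q) :
    errPrivUnitG n d p q = ENNReal.ofReal ((n : ℝ)⁻¹ * unitErr d p q) :=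
  errPrivUnitG_eq hd h.p_mem h.q_mem ((mConst_ne_zero_iff hd).1 h.m_ne_zero)

lemma unitErr_nonneg_of_admissible (hd : 1 ≤ d) (h : Admissible d ε p q) :
    0 ≤ unitErr d p q := by
  refine le_trans ?_ (unitErr_ge d h.p_mem h.q_mem ((mConst_ne_zero_iff hd).1 h.m_ne_zero))
  have : (1 : ℝ) ≤ d := by exact_mod_cast hd
  exact div_nonneg (by linarith) (sq_nonneg _)

lemma exists_optimal (hd : 1 ≤ d) (hε : 0 < ε) : ∃ p q : ℝ, Optimal d ε p q := by
  obtain ⟨t, ht⟩ := exists_min_maxSignal hd hε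
  obtain ⟨p, q, hq, hs, had⟩ := exists_admissible_signal_eq hε t
  refine ⟨p, q, had d hd, fun p' q' h' => ?_⟩
  obtain ⟨s, hs'⟩ := exists_maxSignal_le_unitErr hd hε h'
  rw [errPrivUnitG_of_admissible hd 1 (had d hd), errPrivUnitG_of_admissible hd 1 h']
  refine ENNReal.ofReal_le_ofReal (mul_le_mul_of_nonneg_left ?_ (by simp))
  rw [unitErr, hs, hq]
  linarith [ht s]

end

/-! ### Projected PrivUnitG -/

section

variable {k d : ℕ} {p q ε : ℝ}

lemma measurable_normalizeOr (u₀ : S k) : Measurable (normalizeOr u₀) := by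
  refine measurable_comap_iff.2 ?_
  have h : (Subtype.val ∘ normalizeOr u₀) =
      fun x : E k => if x = 0 then (u₀ : E k) else ‖x‖⁻¹ • x := by
    ext1 x
    by_cases hx : x = 0 <;> simp [normalizeOr, hx]
  rw [h]
  exact Measurable.ite (measurableSet_singleton 0) measurable_const (by fun_prop)

lemma measurable_normalizeOr_apply (u₀ : S k) (x : E d) :
    Measurable fun W : E d →L[ℝ] E k => normalizeOr u₀ (W x) :=
  (measurable_normalizeOr u₀).comp (ContinuousLinearMap.measurable_apply x)

lemma measurable_projSample (u₀ : S k) (x : E d) :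
    Measurable fun ω : (E d →L[ℝ] E k) × (ℝ × E k) =>
      (privUnitGSample k p q (normalizeOr u₀ (ω.1 x)) ω.2, ω.1) :=
  (measurable_privUnitGSample_comp ((measurable_normalizeOr_apply u₀ x).comp measurable_fst)
    (measurable_fst.comp measurable_snd) (measurable_snd.comp measurable_snd)).prodMk
    measurable_fst

lemma measurable_adjoint_apply :
    Measurable fun y : E k × (E d →L[ℝ] E k) => ContinuousLinearMap.adjoint y.2 y.1 := by
  have : Continuous fun y : E k × (E d →L[ℝ] E k) => ContinuousLinearMap.adjoint y.2 y.1 :=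
    ((ContinuousLinearMap.adjoint (𝕜 := ℝ) (E := E d) (F := E k)).continuous.comp
      continuous_snd).clm_apply continuous_fst
  exact this.measurable

/-- Conditionally on the matrix, the message is one of PrivUnitG, so that projecting preserves
privacy. -/
lemma isDP_projClient (μW : Measure (E d →L[ℝ] E k)) [IsProbabilityMeasure μW] (u₀ : S k)
    (hk : 1 ≤ k) (h : Admissible k ε p q) : IsDP ε (projClient μW u₀ p q) := by
  have := isProbabilityMeasure_noiseLaw hk h.p_mem h.q_mem
  have key (x : E d) {T : Set (E k × (E d →L[ℝ] E k))} (hT : MeasurableSet T) :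
      projClient μW u₀ p q x T =
        ∫⁻ W, privUnitG k p q (normalizeOr u₀ (W x)) ((fun y => (y, W)) ⁻¹' T) ∂μW := by
    rw [projClient, Measure.map_apply (measurable_projSample u₀ x) hT,
      Measure.prod_apply (measurable_projSample u₀ x hT)]
    refine lintegral_congr fun W => ?_
    rw [privUnitG, Measure.map_apply (measurable_privUnitGSample _)
      (measurable_prodMk_right hT)]
    rfl
  intro x x' T hT
  rw [key x hT, key x' hT, ← lintegral_const_mul' _ _ ENNReal.ofReal_ne_top]
  exact lintegral_mono fun W => h.isDP _ _ _ (measurable_prodMk_right hT)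

section Moments

variable {μW : Measure (E d →L[ℝ] E k)} [IsProbabilityMeasure μW]

lemma memLp_two_adjoint_apply_projClient (hk : 1 ≤ k) (h : Admissible k ε p q) (u₀ : S k)
    (hW : Integrable (fun W => ‖ContinuousLinearMap.adjoint W‖ ^ 2) μW) (x : E d) :
    MemLp (fun y : E k × (E d →L[ℝ] E k) => ContinuousLinearMap.adjoint y.2 y.1) 2
        (projClient μW u₀ p q x) ∧
      ∫ y, ‖ContinuousLinearMap.adjoint y.2 y.1‖ ^ 2 ∂(projClient μW u₀ p q x) ≤
        (∫ W, ‖ContinuousLinearMap.adjoint W‖ ^ 2 ∂μW) * (unitErr k p q + 1) := by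
  have := isProbabilityMeasure_noiseLaw hk h.p_mem h.q_mem
  have : SigmaFinite μW := IsFiniteMeasure.toSigmaFinite μW
  have hm := (mConst_ne_zero_iff hk).1 h.m_ne_zero
  have hS := measurable_projSample (p := p) (q := q) u₀ x
  have hA := measurable_adjoint_apply (k := k) (d := d)
  -- `g` dominates the squared norm of the estimate
  set g : (E d →L[ℝ] E k) × (ℝ × E k) → ℝ := fun ω =>
    ‖ContinuousLinearMap.adjoint ω.1‖ ^ 2 *
      ‖privUnitGSample k p q (normalizeOr u₀ (ω.1 x)) ω.2‖ ^ 2 with hg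
  have hgm : Measurable g := by
    have h1 : Measurable fun W : E d →L[ℝ] E k => ‖ContinuousLinearMap.adjoint W‖ ^ 2 :=
      ((ContinuousLinearMap.adjoint (𝕜 := ℝ) (E := E d) (F := E k)).continuous.norm.pow
        2).measurable
    exact (h1.comp measurable_fst).mul ((measurable_fst.comp hS).norm.pow_const 2)
  have hinner (W : E d →L[ℝ] E k) : ∫ ω, g (W, ω) ∂(noiseLaw k p q) =
      ‖ContinuousLinearMap.adjoint W‖ ^ 2 * (unitErr k p q + 1) := by
    simp only [hg]
    rw [integral_const_mul, integral_norm_sq_privUnitGSample hk h.p_mem h.q_mem _ hm]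
  have hgi : Integrable g (μW.prod (noiseLaw k p q)) := by
    rw [integrable_prod_iff hgm.aestronglyMeasurable]
    constructor
    · refine .of_forall fun W => ?_
      simp only [hg]
      exact (integrable_norm_sq_privUnitGSample hk h.p_mem h.q_mem _).const_mul _
    · have hn (ω : (E d →L[ℝ] E k) × (ℝ × E k)) : ‖g ω‖ = g ω :=
        Real.norm_of_nonneg (by positivity)
      simp_rw [hn, hinner]
      exact hW.mul_const _
  have hle (ω : (E d →L[ℝ] E k) × (ℝ × E k)) :
      ‖ContinuousLinearMap.adjoint ω.1 (privUnitGSample k p q (normalizeOr u₀ (ω.1 x)) ω.2)‖ ^ 2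
        ≤ g ω := by
    simp only [hg, ← mul_pow]
    gcongr
    exact ContinuousLinearMap.le_opNorm _ _
  have hint : Integrable (fun ω : (E d →L[ℝ] E k) × (ℝ × E k) =>
      ‖ContinuousLinearMap.adjoint ω.1
        (privUnitGSample k p q (normalizeOr u₀ (ω.1 x)) ω.2)‖ ^ 2)
      (μW.prod (noiseLaw k p q)) :=
    hgi.mono' ((hA.comp hS).norm.pow_const 2).aestronglyMeasurable
      (.of_forall fun ω => by rw [Real.norm_of_nonneg (by positivity)]; exact hle ω)
  constructor
  · rw [memLp_two_iff_integrable_sq_norm hA.aestronglyMeasurable, projClient,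
      integrable_map_measure (hA.norm.pow_const 2).aestronglyMeasurable hS.aemeasurable]
    exact hint
  · rw [projClient, integral_map hS.aemeasurable (hA.norm.pow_const 2).aestronglyMeasurable]
    refine (integral_mono hint hgi hle).trans_eq ?_
    rw [integral_prod _ hgi]
    simp_rw [hinner]
    rw [integral_mul_const]

/-- Since PrivUnitG is unbiased, the bias of one client is only that of the random projection. -/
lemma integral_adjoint_apply_projClient (hk : 1 ≤ k) (h : Admissible k ε p q) (u₀ : S k)
    (hW : Integrable (fun W => ‖ContinuousLinearMap.adjoint W‖ ^ 2) μW) (x : E d) :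
    ∫ y, ContinuousLinearMap.adjoint y.2 y.1 ∂(projClient μW u₀ p q x) =
      ∫ W, ContinuousLinearMap.adjoint W (normalizeOr u₀ (W x) : E k) ∂μW := by
  have := isProbabilityMeasure_noiseLaw hk h.p_mem h.q_mem
  have : SigmaFinite μW := IsFiniteMeasure.toSigmaFinite μW
  have hm := (mConst_ne_zero_iff hk).1 h.m_ne_zero
  have hS := measurable_projSample (p := p) (q := q) u₀ x
  have hA := measurable_adjoint_apply (k := k) (d := d)
  have : IsProbabilityMeasure (projClient μW u₀ p q x) :=
    Measure.isProbabilityMeasure_map hS.aemeasurable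
  have hi := (memLp_two_adjoint_apply_projClient hk h u₀ hW x).1.integrable one_le_two
  rw [projClient, integrable_map_measure hA.aestronglyMeasurable hS.aemeasurable] at hi
  rw [projClient, integral_map hS.aemeasurable hA.aestronglyMeasurable]
  refine (integral_prod _ hi).trans (integral_congr_ae (.of_forall fun W => ?_))
  have := (ContinuousLinearMap.adjoint W).integral_comp_comm
    ((memLp_two_privUnitGSample hk h.p_mem h.q_mem (normalizeOr u₀ (W x))).integrable one_le_two)
  rw [integral_privUnitGSample hk h.p_mem h.q_mem _ hm] at this
  exact this

lemma mse_projServer_le {n : ℕ} {α B : ℝ} (hk : 1 ≤ k) (h : Admissible k ε p q) (u₀ : S k)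
    (hα : 0 ≤ α) (hW : Integrable (fun W => ‖ContinuousLinearMap.adjoint W‖ ^ 2) μW)
    (hB : ∫ W, ‖ContinuousLinearMap.adjoint W‖ ^ 2 ∂μW ≤ B)
    (hbias : ∀ v : S d,
      ‖(∫ W, ContinuousLinearMap.adjoint W (normalizeOr u₀ (W v) : E k) ∂μW) - (v : E d)‖
        ≤ √α) (v : Fin n → S d) :
    mse projServer (fun x : S d => projClient μW u₀ p q (x : E d)) v ≤
      ENNReal.ofReal ((n : ℝ)⁻¹ * (B * (unitErr k p q + 1)) + α) := by
  have := isProbabilityMeasure_noiseLaw hk h.p_mem h.q_mem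
  have (x : S d) : IsProbabilityMeasure (projClient μW u₀ p q (x : E d)) :=
    Measure.isProbabilityMeasure_map (measurable_projSample u₀ (x : E d)).aemeasurable
  have hmom (i : Fin n) := memLp_two_adjoint_apply_projClient hk h u₀ hW (v i : E d)
  have hne := unitErr_nonneg_of_admissible hk h
  have hdec := lintegral_norm_average_sub_sq (fun i => projClient μW u₀ p q (v i : E d))
    (fun i => (hmom i).1) ((n : ℝ)⁻¹ • ∑ i, (v i : E d))
  simp only [mse, projServer]
  rw [hdec]
  refine ENNReal.ofReal_le_ofReal (add_le_add ?_ ?_)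
  · calc (n : ℝ)⁻¹ ^ 2 * ∑ i, (∫ y, ‖ContinuousLinearMap.adjoint y.2 y.1‖ ^ 2
            ∂(projClient μW u₀ p q (v i : E d)) -
          ‖∫ y, ContinuousLinearMap.adjoint y.2 y.1 ∂(projClient μW u₀ p q (v i : E d))‖ ^ 2)
        ≤ (n : ℝ)⁻¹ ^ 2 * ∑ _i : Fin n, B * (unitErr k p q + 1) := by
          gcongr with i
          have h1 := (hmom i).2
          have h2 := mul_le_mul_of_nonneg_right hB (by linarith : 0 ≤ unitErr k p q + 1)
          nlinarith [sq_nonneg ‖∫ y, ContinuousLinearMap.adjoint y.2 y.1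
            ∂(projClient μW u₀ p q (v i : E d))‖]
      _ = (n : ℝ)⁻¹ * (B * (unitErr k p q + 1)) := by
          rcases eq_or_ne n 0 with rfl | hn
          · simp
          · rw [Finset.sum_const, Finset.card_univ, Fintype.card_fin, nsmul_eq_mul]
            field_simp
  · simp_rw [integral_adjoint_apply_projClient hk h u₀ hW]
    rw [← smul_sub, ← Finset.sum_sub_distrib, norm_smul, ← Real.sq_sqrt hα]
    gcongr
    calc ‖(n : ℝ)⁻¹‖ * ‖∑ i, ((∫ W, ContinuousLinearMap.adjoint W
            (normalizeOr u₀ (W (v i : E d)) : E k) ∂μW) - (v i : E d))‖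
        ≤ ‖(n : ℝ)⁻¹‖ * ∑ _i : Fin n, √α := by
          gcongr
          exact norm_sum_le_of_le _ fun i _ => hbias (v i)
      _ ≤ √α := by
          rcases eq_or_ne n 0 with rfl | hn
          · simp
          · simp [hn]

end Moments

end

end ProjUnit

theorem mainTheorem1 :
    -- optimized parameters for PrivUnitG exist
    (∀ (d : ℕ) (ε : ℝ), 1 ≤ d → 0 < ε → ∃ p q : ℝ, ProjUnit.Optimal d ε p q) ∧
    -- the constant in `O(·)` is absolute
    ∃ C : ℝ, 0 < C ∧
      ∀ (k d : ℕ) (ε : ℝ), 1 ≤ k → k ≤ d → 2 ≤ d → 0 < ε →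
      -- optimized parameters in dimensions `k` and `d`
      ∀ (p q p' q' : ℝ), ProjUnit.Optimal k ε p q → ProjUnit.Optimal d ε p' q' →
      ∀ (μW : Measure (ProjUnit.E d →L[ℝ] ProjUnit.E k)) [IsProbabilityMeasure μW]
        (u₀ : ProjUnit.S k) (α β : ℝ), 0 ≤ α →
      -- bounded operator norm
      Integrable (fun W => ‖ContinuousLinearMap.adjoint W‖ ^ 2) μW →
      ∫ W, ‖ContinuousLinearMap.adjoint W‖ ^ 2 ∂μW ≤ (d : ℝ) / k + β →
      -- bounded bias
      (∀ v : ProjUnit.S d,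
        ‖(∫ W, ContinuousLinearMap.adjoint W (ProjUnit.normalizeOr u₀ (W v) : ProjUnit.E k) ∂μW)
          - (v : ProjUnit.E d)‖ ≤ Real.sqrt α) →
      ProjUnit.IsDP ε (ProjUnit.projClient μW u₀ p q) ∧
      ∀ (n : ℕ) (v : Fin n → ProjUnit.S d),
        ProjUnit.mse ProjUnit.projServer
            (fun x : ProjUnit.S d => ProjUnit.projClient μW u₀ p q (x : ProjUnit.E d)) v
          ≤ ENNReal.ofReal
              ((ProjUnit.errPrivUnitG n d p' q').toReal *
                (1 + k * β / d + C * (1 + k * β / d) * ((ε + Real.log k) / k)) + α) := by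
  refine ⟨fun d ε hd hε => ProjUnit.exists_optimal hd hε, 22, by norm_num, ?_⟩
  intro k d ε hk hkd hd hε p q p' q' hopt hopt' μW _ u₀ α β hα hW hB hbias
  refine ⟨ProjUnit.isDP_projClient μW u₀ hk hopt.admissible, fun n v => ?_⟩
  refine (ProjUnit.mse_projServer_le hk hopt.admissible u₀ hα hW hB hbias v).trans ?_
  have hd1 : 1 ≤ d := by omega
  have hk0 : (0 : ℝ) < k := by exact_mod_cast hk
  have hd0 : (0 : ℝ) < d := by exact_mod_cast hd1
  -- the parameters for dimension `d` are admissible in dimension `k`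
  have had : ProjUnit.Admissible k ε p' q' :=
    (ProjUnit.admissible_iff hk hε.le).2 ((ProjUnit.admissible_iff hd1 hε.le).1 hopt'.admissible)
  have hle : ProjUnit.unitErr k p q ≤ ProjUnit.unitErr k p' q' := by
    have h := hopt.le p' q' had
    rw [ProjUnit.errPrivUnitG_of_admissible hk 1 hopt.admissible,
      ProjUnit.errPrivUnitG_of_admissible hk 1 had] at h
    simpa using (ENNReal.ofReal_le_ofReal_iff
      (by simpa using ProjUnit.unitErr_nonneg_of_admissible hk had)).1 h
  have hcmp := ProjUnit.div_mul_unitErr_add_one_le hk hkd hd hε hopt'.admissible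
  have hu := ProjUnit.unitErr_nonneg_of_admissible hd1 hopt'.admissible
  rw [ProjUnit.errPrivUnitG_of_admissible hd1 n hopt'.admissible,
    ENNReal.toReal_ofReal (by positivity)]
  refine ENNReal.ofReal_le_ofReal (add_le_add_left ?_ α)
  have hlog : 0 ≤ Real.log k := Real.log_nonneg (by exact_mod_cast hk)
  have hs : 0 ≤ 1 + k * β / d := by
    have h0 : 0 ≤ (d : ℝ) / k + β := (integral_nonneg fun W => sq_nonneg _).trans hB
    have : 1 + k * β / d = (k / d) * (d / k + β) := by field_simp
    rw [this]
    positivity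
  calc (n : ℝ)⁻¹ * ((d / k + β) * (ProjUnit.unitErr k p q + 1))
      = (n : ℝ)⁻¹ * ((1 + k * β / d) * (d / k * (ProjUnit.unitErr k p q + 1))) := by
        field_simp
    _ ≤ (n : ℝ)⁻¹ * ((1 + k * β / d) * (d / k * (ProjUnit.unitErr k p' q' + 1))) := by
        gcongr
    _ ≤ (n : ℝ)⁻¹ * ((1 + k * β / d) *
          (ProjUnit.unitErr d p' q' * (1 + 22 * ((ε + Real.log k) / k)))) := by
        refine mul_le_mul_of_nonneg_left (mul_le_mul_of_nonneg_left (hcmp.trans ?_) hs)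
          (by positivity)
        gcongr
        linarith
    _ = _ := by ring
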